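/- Fix standard bases of $\mathbb{C}^{d_1}$ and $\mathbb{C}^{d_2}$. For an operator $X$ on $\mathbb{C}^{d_1}\otimes\mathbb{C}^{d_2}$ let $X^\Gamma$ denote the partial transpose on the first tensor factor. A density operator $\rho$ is NPT if $\rho^\Gamma\not\geq0$. A positive operator is separable if it is a finite sum $\sum_i\tau_i\otimes\omega_i$ with $\tau_i,\omega_i\geq 0$; a density operator that is not separable is entangled. A completely positive map $\Lambda$ from the operators on $\mathcal{H}_{A_1}\otimes\mathcal{H}_{B_1}$ to those on $\mathcal{H}_{A_2}\otimes\mathcal{H}_{B_2}$ is non-entangling if it maps separable operators to separable operators; it is dually non-entangling if both $\Lambda$ and its dual map $\Lambda^*$ (defined by $\mathrm{Tr}(\Lambda(X)Y)=\mathrm{Tr}(X\Lambda^*(Y))$ for all $X,Y$) are non-entangling; it is PPT if its Choi operator $J(\Lambda)=\sum_{i,j}\Lambda(|i\rangle\langle j|)\otimes|i\rangle\langle j|$ has a positive semidefinite partial transpose with respect to the cut $A_2A_1:B_2B_1$. A channel is a completely positive trace-preserving linear map. Let $|\phi_2^+\rangle=\frac{1}{\sqrt2}(|11\rangle+|22\rangle)$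 and $\phi_2^+=|\phi_2^+\rangle\langle\phi_2^+|$. A bipartite state $\omega$ is LOCC-distillable if there are channels $\Lambda_n$, each implementable by finitely many rounds of local operations and classical communication, with $\lim_{n\to\infty}\lVert\Lambda_n(\omega^{\otimes n})-\phi_2^+\rVert_1=0$, where $\lVert\cdot\rVert_1$ is the trace norm. **Theorem.** Every NPT state $\rho$ on $\mathbb{C}^{d_1}\otimes\mathbb{C}^{d_2}$ can be mapped, by a channel that is both dually non-entangling and PPT, to an entangled two-qubit state, which is LOCC-distillable. More precisely, $\rho^\Gamma$ has a unit eigenvector with a negative eigenvalue, and for every such unit eigenvector $|\eta\rangle$, with $W=|\eta\rangle\langle\eta|^\Gamma$ and $A=\frac13(W+2\cdot\mathbb{1})$, the map $$\Lambda(X)=\mathrm{Tr}(AX)\,\tfrac14\mathbb{1}_4+\mathrm{Tr}((\mathbb{1}-A)X)\,\phi_2^+$$ is a channel that is both dually non-entangling and PPT, and $\Lambda(\rho)$ is an entangled two-qubit state that is LOCC-distillable. -/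

import Mathlib

open Matrix Filter Topology
open scoped Kronecker TensorProduct ComplexOrder

noncomputable section

namespace QEnt

/-- Density operators: positive semidefinite with trace one. -/
def IsState {d : Type*} [Fintype d] (ρ : Matrix d d ℂ) : Prop :=
  ρ.PosSemidef ∧ ρ.trace = 1

/-- A positive operator on `ℂ^a ⊗ ℂ^b` is separable if it is a finite sum of tensor products of
positive operators. -/
def IsSeparable {a b : Type*} (σ : Matrix (a × b) (a × b) ℂ) : Prop :=
  ∃ (n : ℕ) (τ : Fin n → Matrix a a ℂ) (ω : Fin n → Matrix b b ℂ),
    (∀ i, (τ i).PosSemidef) ∧ (∀ i, (ω i).PosSemidef) ∧ σ = ∑ i, τ i ⊗ₖ ω i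

/-- An entangled state is a density operator which is not separable. -/
def IsEntangledState {a b : Type*} [Fintype a] [Fintype b]
    (ρ : Matrix (a × b) (a × b) ℂ) : Prop :=
  IsState ρ ∧ ¬ IsSeparable ρ

/-- The partial transpose `X^Γ` on the first tensor factor, in the standard basis. -/
def partialTranspose {a b : Type*} (X : Matrix (a × b) (a × b) ℂ) : Matrix (a × b) (a × b) ℂ :=
  Matrix.of fun p q => X (q.1, p.2) (p.1, q.2)

/-- An NPT state is a density operator whose partial transpose is not positive semidefinite. -/
def IsNPTState {a b : Type*} [Fintype a] [Fintype b]
    (ρ : Matrix (a × b) (a × b) ℂ) : Prop :=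
  IsState ρ ∧ ¬ (partialTranspose ρ).PosSemidef

/-- The tensor product `Φ ⊗ Ψ` of two linear maps between spaces of operators, acting on the
operators on the tensor product space. -/
def tensorMap {a b a' b' : Type*} [Fintype a] [DecidableEq a] [Fintype b] [DecidableEq b]
    [Fintype a'] [DecidableEq a'] [Fintype b'] [DecidableEq b']
    (Φ : Matrix a a ℂ →ₗ[ℂ] Matrix a' a' ℂ) (Ψ : Matrix b b ℂ →ₗ[ℂ] Matrix b' b' ℂ) :
    Matrix (a × b) (a × b) ℂ →ₗ[ℂ] Matrix (a' × b') (a' × b') ℂ :=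
  (kroneckerLinearEquiv a' a' b' b' ℂ).toLinearMap ∘ₗ TensorProduct.map Φ Ψ ∘ₗ
    (kroneckerLinearEquiv a a b b ℂ).symm.toLinearMap

/-- The defining property of the tensor product of two maps. -/
theorem tensorMap_kronecker {a b a' b' : Type*} [Fintype a] [DecidableEq a] [Fintype b]
    [DecidableEq b] [Fintype a'] [DecidableEq a'] [Fintype b'] [DecidableEq b']
    (Φ : Matrix a a ℂ →ₗ[ℂ] Matrix a' a' ℂ) (Ψ : Matrix b b ℂ →ₗ[ℂ] Matrix b' b' ℂ)
    (X : Matrix a a ℂ) (Y : Matrix b b ℂ) :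
    tensorMap Φ Ψ (X ⊗ₖ Y) = Φ X ⊗ₖ Ψ Y := by
  simp [tensorMap]

/-- Complete positivity: `id_k ⊗ Φ` preserves positive semidefiniteness for every ancilla `ℂ^k`. -/
def IsCompletelyPositive {d d' : Type*} [Fintype d] [DecidableEq d] [Fintype d'] [DecidableEq d']
    (Φ : Matrix d d ℂ →ₗ[ℂ] Matrix d' d' ℂ) : Prop :=
  ∀ (k : ℕ) (M : Matrix (Fin k × d) (Fin k × d) ℂ), M.PosSemidef →
    (tensorMap (LinearMap.id : Matrix (Fin k) (Fin k) ℂ →ₗ[ℂ] Matrix (Fin k) (Fin k) ℂ) Φ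
      M).PosSemidef

/-- Trace preservation. -/
def IsTracePreserving {d d' : Type*} [Fintype d] [Fintype d']
    (Φ : Matrix d d ℂ →ₗ[ℂ] Matrix d' d' ℂ) : Prop :=
  ∀ X, (Φ X).trace = X.trace

/-- A quantum channel is a completely positive trace-preserving linear map. -/
def IsChannel {d d' : Type*} [Fintype d] [DecidableEq d] [Fintype d'] [DecidableEq d']
    (Φ : Matrix d d ℂ →ₗ[ℂ] Matrix d' d' ℂ) : Prop :=
  IsCompletelyPositive Φ ∧ IsTracePreserving Φ

/-- The dual map `Λ^*`, i.e. the unique linear map with `Tr(Λ(X) Y) = Tr(X Λ^*(Y))` for all `X, Y`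
(see `trace_dualMap`). -/
def dualMap {d d' : Type*} [DecidableEq d] [Fintype d']
    (Φ : Matrix d d ℂ →ₗ[ℂ] Matrix d' d' ℂ) : Matrix d' d' ℂ →ₗ[ℂ] Matrix d d ℂ where
  toFun Y := Matrix.of fun i j => (Φ (Matrix.single j i 1) * Y).trace
  map_add' Y Z := by ext i j; simp [mul_add]
  map_smul' c Y := by ext i j; simp

/-- The property which characterises the dual map. -/
theorem trace_dualMap {d d' : Type*} [Fintype d] [DecidableEq d] [Fintype d']
    (Φ : Matrix d d ℂ →ₗ[ℂ] Matrix d' d' ℂ) (X : Matrix d d ℂ) (Y : Matrix d' d' ℂ) :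
    (Φ X * Y).trace = (X * dualMap Φ Y).trace := by
  induction X using Matrix.induction_on' with
  | h_zero => simp
  | h_add p q hp hq => simp [add_mul, hp, hq]
  | h_std_basis i j x =>
    have h : Matrix.single i j x = x • Matrix.single i j (1 : ℂ) := by simp
    rw [h, map_smul, smul_mul_assoc, smul_mul_assoc, trace_smul, trace_smul]
    congr 1
    simp [Matrix.trace_single_mul, dualMap]

/-- The Choi representation `J(Λ) = (Λ ⊗ id)(∑ᵢⱼ |i⟩⟨j| ⊗ |i⟩⟨j|)`. -/
def choi {d d' : Type*} [Fintype d] [DecidableEq d]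
    (Φ : Matrix d d ℂ →ₗ[ℂ] Matrix d' d' ℂ) : Matrix (d' × d) (d' × d) ℂ :=
  ∑ i, ∑ j, Φ (Matrix.single i j 1) ⊗ₖ Matrix.single i j 1

/-- Regrouping of an operator on `(A₂ ⊗ B₂) ⊗ (A₁ ⊗ B₁)` as one on `(A₂ ⊗ A₁) ⊗ (B₂ ⊗ B₁)`. -/
def regroup {a₂ b₂ a₁ b₁ : Type*} (J : Matrix ((a₂ × b₂) × (a₁ × b₁)) ((a₂ × b₂) × (a₁ × b₁)) ℂ) :
    Matrix ((a₂ × a₁) × (b₂ × b₁)) ((a₂ × a₁) × (b₂ × b₁)) ℂ :=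
  Matrix.reindex (Equiv.prodProdProdComm a₂ b₂ a₁ b₁) (Equiv.prodProdProdComm a₂ b₂ a₁ b₁) J

/-- A PPT map is a completely positive map whose Choi representation has a positive partial
transpose with respect to the cut `A₂A₁ : B₂B₁`. -/
def IsPPTMap {a₁ b₁ a₂ b₂ : Type*} [Fintype a₁] [DecidableEq a₁] [Fintype b₁] [DecidableEq b₁]
    [Fintype a₂] [DecidableEq a₂] [Fintype b₂] [DecidableEq b₂]
    (Λ : Matrix (a₁ × b₁) (a₁ × b₁) ℂ →ₗ[ℂ] Matrix (a₂ × b₂) (a₂ × b₂) ℂ) : Prop :=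
  IsCompletelyPositive Λ ∧ (partialTranspose (regroup (choi Λ))).PosSemidef

/-- A non-entangling (separable-preserving) map is a completely positive map which sends separable
operators to separable operators. -/
def IsNonEntangling {a₁ b₁ a₂ b₂ : Type*} [Fintype a₁] [DecidableEq a₁] [Fintype b₁]
    [DecidableEq b₁] [Fintype a₂] [DecidableEq a₂] [Fintype b₂] [DecidableEq b₂]
    (Λ : Matrix (a₁ × b₁) (a₁ × b₁) ℂ →ₗ[ℂ] Matrix (a₂ × b₂) (a₂ × b₂) ℂ) : Prop :=
  IsCompletelyPositive Λ ∧ ∀ σ, IsSeparable σ → IsSeparable (Λ σ)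

/-- A map is dually non-entangling if the map and its dual are both non-entangling. -/
def IsDuallyNonEntangling {a₁ b₁ a₂ b₂ : Type*} [Fintype a₁] [DecidableEq a₁] [Fintype b₁]
    [DecidableEq b₁] [Fintype a₂] [DecidableEq a₂] [Fintype b₂] [DecidableEq b₂]
    (Λ : Matrix (a₁ × b₁) (a₁ × b₁) ℂ →ₗ[ℂ] Matrix (a₂ × b₂) (a₂ × b₂) ℂ) : Prop :=
  IsNonEntangling Λ ∧ IsNonEntangling (dualMap Λ)

/-- A (finite) quantum instrument: completely positive maps, indexed by the measurement outcomes,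
whose sum is trace preserving. -/
def IsInstrument {d d' ι : Type*} [Fintype d] [DecidableEq d] [Fintype d'] [DecidableEq d']
    [Fintype ι] (E : ι → (Matrix d d ℂ →ₗ[ℂ] Matrix d' d' ℂ)) : Prop :=
  (∀ x, IsCompletelyPositive (E x)) ∧ IsTracePreserving (∑ x, E x)

/-- Channels implementable by local operations and classical communication in finitely many rounds.
Either both parties apply local channels and stop, or one of the parties performs a local
instrument and broadcasts the outcome `x`, after which the parties continue with an LOCC protocol
that may depend on `x`. -/
inductive IsLOCC {a' b' : Type} [Fintype a'] [DecidableEq a'] [Fintype b'] [DecidableEq b'] :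
    ∀ {a b : Type} [Fintype a] [DecidableEq a] [Fintype b] [DecidableEq b],
      (Matrix (a × b) (a × b) ℂ →ₗ[ℂ] Matrix (a' × b') (a' × b') ℂ) → Prop
  | localOps {a b : Type} [Fintype a] [DecidableEq a] [Fintype b] [DecidableEq b]
      (Φ : Matrix a a ℂ →ₗ[ℂ] Matrix a' a' ℂ) (Ψ : Matrix b b ℂ →ₗ[ℂ] Matrix b' b' ℂ)
      (hΦ : IsChannel Φ) (hΨ : IsChannel Ψ) : IsLOCC (tensorMap Φ Ψ)
  | alice {a b c ι : Type} [Fintype a] [DecidableEq a] [Fintype b] [DecidableEq b]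
      [Fintype c] [DecidableEq c] [Fintype ι]
      (E : ι → (Matrix a a ℂ →ₗ[ℂ] Matrix c c ℂ)) (hE : IsInstrument E)
      (Λ : ι → (Matrix (c × b) (c × b) ℂ →ₗ[ℂ] Matrix (a' × b') (a' × b') ℂ))
      (hΛ : ∀ x, IsLOCC (Λ x)) :
      IsLOCC (∑ x, Λ x ∘ₗ tensorMap (E x) (LinearMap.id : Matrix b b ℂ →ₗ[ℂ] Matrix b b ℂ))
  | bob {a b c ι : Type} [Fintype a] [DecidableEq a] [Fintype b] [DecidableEq b]
      [Fintype c] [DecidableEq c] [Fintype ι]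
      (E : ι → (Matrix b b ℂ →ₗ[ℂ] Matrix c c ℂ)) (hE : IsInstrument E)
      (Λ : ι → (Matrix (a × c) (a × c) ℂ →ₗ[ℂ] Matrix (a' × b') (a' × b') ℂ))
      (hΛ : ∀ x, IsLOCC (Λ x)) :
      IsLOCC (∑ x, Λ x ∘ₗ tensorMap (LinearMap.id : Matrix a a ℂ →ₗ[ℂ] Matrix a a ℂ) (E x))

/-- The state vector `|φ_d⁺⟩ = d^{-1/2} ∑ᵢ |ii⟩`. -/
def phiPlusVec (d : ℕ) : Fin d × Fin d → ℂ :=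
  fun p => if p.1 = p.2 then ((1 / Real.sqrt d : ℝ) : ℂ) else 0

/-- The maximally entangled state `φ_d⁺ = |φ_d⁺⟩⟨φ_d⁺|`. -/
def phiPlus (d : ℕ) : Matrix (Fin d × Fin d) (Fin d × Fin d) ℂ :=
  vecMulVec (phiPlusVec d) (star (phiPlusVec d))

/-- The trace norm: the sum of the singular values. -/
def traceNorm {d : Type*} [Fintype d] [DecidableEq d] (X : Matrix d d ℂ) : ℝ :=
  ∑ i, Real.sqrt ((isHermitian_conjTranspose_mul_self X).eigenvalues i)

/-- The tensor power `ρ^{⊗n}`, as an operator on `A^{⊗n} ⊗ B^{⊗n}`. -/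
def tensorPower {a b : Type*} (ρ : Matrix (a × b) (a × b) ℂ) (n : ℕ) :
    Matrix ((Fin n → a) × (Fin n → b)) ((Fin n → a) × (Fin n → b)) ℂ :=
  Matrix.of fun p q => ∏ k, ρ (p.1 k, p.2 k) (q.1 k, q.2 k)

/-- A bipartite state `ρ` is LOCC-distillable if there are LOCC channels `Λₙ` for which
`Λₙ(ρ^{⊗n})` converges to the two-qubit maximally entangled state in trace norm. -/
def IsLOCCDistillable {a b : Type} [Fintype a] [DecidableEq a] [Fintype b] [DecidableEq b]
    (ρ : Matrix (a × b) (a × b) ℂ) : Prop :=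
  ∃ Λ : ∀ n : ℕ, (Matrix ((Fin n → a) × (Fin n → b)) ((Fin n → a) × (Fin n → b)) ℂ →ₗ[ℂ]
      Matrix (Fin 2 × Fin 2) (Fin 2 × Fin 2) ℂ),
    (∀ n, IsLOCC (Λ n)) ∧
      Tendsto (fun n => traceNorm (Λ n (tensorPower ρ n) - phiPlus 2)) atTop (𝓝 0)

/-- `η` is a unit vector which is an eigenvector of `M` with a negative eigenvalue. -/
def IsNegativeUnitEigenvector {d : Type*} [Fintype d] (M : Matrix d d ℂ) (η : d → ℂ) : Prop :=
  star η ⬝ᵥ η = 1 ∧ ∃ μ : ℝ, μ < 0 ∧ M *ᵥ η = (μ : ℂ) • η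

/-- The operator `W = |η⟩⟨η|^Γ`. -/
def witness {a b : Type*} (η : a × b → ℂ) : Matrix (a × b) (a × b) ℂ :=
  partialTranspose (vecMulVec η (star η))

/-- The operator `A = (W + 2 𝟙) / 3`. -/
def testOperator {a b : Type*} [DecidableEq a] [DecidableEq b] (η : a × b → ℂ) :
    Matrix (a × b) (a × b) ℂ :=
  (1 / 3 : ℂ) • (witness η + (2 : ℂ) • (1 : Matrix (a × b) (a × b) ℂ))

/-- The map `Λ(X) = Tr(A X) 𝟙₄/4 + Tr((𝟙 - A) X) φ₂⁺` into the operators on two qubits. -/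
def measurePrepare {d : Type*} [Fintype d] [DecidableEq d] (A : Matrix d d ℂ) :
    Matrix d d ℂ →ₗ[ℂ] Matrix (Fin 2 × Fin 2) (Fin 2 × Fin 2) ℂ where
  toFun X := (A * X).trace • ((1 / 4 : ℂ) • (1 : Matrix (Fin 2 × Fin 2) (Fin 2 × Fin 2) ℂ)) +
    ((1 - A) * X).trace • phiPlus 2
  map_add' X Y := by simp only [mul_add, trace_add]; module
  map_smul' c X := by
    simp only [Matrix.mul_smul, trace_smul, RingHom.id_apply, smul_eq_mul]; module

end QEnt

end

open QEnt

/-!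
The operator `W = |η⟩⟨η|^Γ` is an entanglement witness. Write `η = ∑ᵢ rᵢ |i⟩ ⊗ uᵢ` with unit
vectors `uᵢ`; the coherence between the terms `i` and `j` becomes a separable operator once a
suitable product operator is added, which shows that `2 ± |η⟩⟨η|`, and hence `2 ± W`, are
separable, while `W ≤ 1`. Every output of `Λ` is isotropic, that is `x 𝟙 + 2 y φ₂⁺`, with
`4 (x - y) = Tr(WX)`; it is separable exactly when `y ≤ x`, which holds for separable `X` because
`W` is a witness, and fails for `ρ`, where `Tr(Wρ)` is the negative eigenvalue. Dually,
`Tr(φ₂⁺ σ) ≤ Tr(σ) / 2` for separable `σ` makes `Λ^*(σ)` a nonnegative combination of the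
separable operators `A` and `4 - W`.

To distil an isotropic state with `x < y`, decode a concatenated repetition code by local filters:
an `n`-fold repetition in the computational basis suppresses the bit errors, and an `m`-fold
repetition in the conjugate basis then suppresses the phase errors. The fidelity with `φ₂⁺`
conditional on success becomes arbitrarily close to one, and the filter can be repeated on fresh
copies until it succeeds.
-/

noncomputable section

namespace QEnt

section PosSemidef

variable {d : Type*} [Fintype d]

open scoped MatrixOrder in
theorem exists_eq_conjTranspose_mul_self {A : Matrix d d ℂ} (hA : A.PosSemidef) :
    ∃ S : Matrix d d ℂ, A = Sᴴ * S := by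
  classical
  exact CStarAlgebra.nonneg_iff_eq_star_mul_self.mp (nonneg_iff_posSemidef.mpr hA)

theorem trace_mul_nonneg {P Q : Matrix d d ℂ} (hP : P.PosSemidef) (hQ : Q.PosSemidef) :
    0 ≤ (P * Q).trace := by
  obtain ⟨S, rfl⟩ := exists_eq_conjTranspose_mul_self hP
  rw [Matrix.mul_assoc, trace_mul_comm]
  exact (hQ.mul_mul_conjTranspose_same S).trace_nonneg

theorem posSemidef_trace_smul_one_sub [DecidableEq d] {G : Matrix d d ℂ} (hG : G.PosSemidef) :
    (G.trace • 1 - G).PosSemidef := by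
  set U := hG.isHermitian.eigenvectorUnitary
  have eigenvalue_le (i) : hG.isHermitian.eigenvalues i ≤ ∑ j, hG.isHermitian.eigenvalues j :=
    Finset.single_le_sum (fun j _ => hG.eigenvalues_nonneg j) (Finset.mem_univ i)
  have hdiag : (diagonal fun i => G.trace - hG.isHermitian.eigenvalues i).PosSemidef := by
    refine PosSemidef.diagonal fun i => ?_
    rw [hG.isHermitian.trace_eq_sum_eigenvalues, ← RCLike.ofReal_sum, Pi.zero_apply, sub_nonneg]
    exact Complex.real_le_real.mpr (eigenvalue_le i)
  convert hdiag.mul_mul_conjTranspose_same (U : Matrix d d ℂ) using 1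
  have hU : (U : Matrix d d ℂ) * (U : Matrix d d ℂ)ᴴ = 1 := Unitary.mul_star_self_of_mem U.2
  have hsplit : (diagonal fun i => G.trace - (hG.isHermitian.eigenvalues i : ℂ)) =
      G.trace • 1 - diagonal (RCLike.ofReal ∘ hG.isHermitian.eigenvalues) := by
    rw [smul_one_eq_diagonal, diagonal_sub]; rfl
  rw [hsplit, Matrix.mul_sub, Matrix.sub_mul, Matrix.mul_smul, Matrix.mul_one, Matrix.smul_mul, hU]
  congr 1
  exact hG.isHermitian.spectral_theorem

theorem posSemidef_one_sub_of_sq [DecidableEq d] {H : Matrix d d ℂ} (hH : H.IsHermitian)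
    (h : (1 - H * H).PosSemidef) : (1 - H).PosSemidef := by
  have hsq : ((1 - H) * (1 - H)).PosSemidef := by
    have h1 : (1 - H)ᴴ = 1 - H := by rw [conjTranspose_sub, conjTranspose_one, hH.eq]
    nth_rw 1 [← h1]
    exact posSemidef_conjTranspose_mul_self _
  have key : 1 - H = (1 / 2 : ℂ) • ((1 - H) * (1 - H) + (1 - H * H)) := by
    rw [Matrix.mul_sub, Matrix.mul_one, Matrix.sub_mul, Matrix.one_mul]; module
  rw [key]
  exact (hsq.add h).smul (by positivity)

theorem posSemidef_one_add_of_sq [DecidableEq d] {H : Matrix d d ℂ} (hH : H.IsHermitian)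
    (h : (1 - H * H).PosSemidef) : (1 + H).PosSemidef := by
  rw [← sub_neg_eq_add]
  exact posSemidef_one_sub_of_sq hH.neg (by rwa [neg_mul_neg])

theorem posSemidef_one_sub_of_involution [DecidableEq d] {H : Matrix d d ℂ} (hH : H.IsHermitian)
    (h : H * H = 1) : (1 - H).PosSemidef :=
  posSemidef_one_sub_of_sq hH (by rw [h, sub_self]; exact PosSemidef.zero)

theorem posSemidef_one_add_of_involution [DecidableEq d] {H : Matrix d d ℂ} (hH : H.IsHermitian)
    (h : H * H = 1) : (1 + H).PosSemidef :=
  posSemidef_one_add_of_sq hH (by rw [h, sub_self]; exact PosSemidef.zero)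

theorem posSemidef_one_sub_vecMulVec [DecidableEq d] {u : d → ℂ} (hu : star u ⬝ᵥ u = 1) :
    (1 - vecMulVec u (star u)).PosSemidef := by
  have h := posSemidef_trace_smul_one_sub (posSemidef_vecMulVec_self_star u)
  rwa [trace_vecMulVec, dotProduct_comm, hu, one_smul] at h

theorem exists_eq_smul_posSemidef_one_sub [DecidableEq d] (v : d → ℂ) :
    ∃ (r : ℝ) (u : d → ℂ), v = (r : ℂ) • u ∧ (r : ℂ) ^ 2 = star v ⬝ᵥ v ∧
      (1 - vecMulVec u (star u)).PosSemidef := by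
  obtain ⟨s, hs, hsv⟩ : ∃ s : ℝ, 0 ≤ s ∧ (s : ℂ) = star v ⬝ᵥ v :=
    RCLike.nonneg_iff_exists_ofReal.mp (dotProduct_star_self_nonneg v)
  have hr : ((√s : ℝ) : ℂ) ^ 2 = star v ⬝ᵥ v := by
    rw [← hsv, ← Complex.ofReal_pow, Real.sq_sqrt hs]
  rcases eq_or_ne (√s) 0 with h0 | h0
  · have hv : v = 0 := by
      rw [h0, Complex.ofReal_zero, zero_pow two_ne_zero] at hr
      exact dotProduct_star_self_eq_zero.mp hr.symm
    exact ⟨√s, 0, by rw [hv, smul_zero], hr, by simpa using PosSemidef.one⟩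
  · have h0' : ((√s : ℝ) : ℂ) ≠ 0 := Complex.ofReal_ne_zero.mpr h0
    refine ⟨√s, ((√s : ℝ) : ℂ)⁻¹ • v, by rw [smul_inv_smul₀ h0'], hr,
      posSemidef_one_sub_vecMulVec ?_⟩
    rw [star_smul, smul_dotProduct, dotProduct_smul, ← hr, star_inv₀, RCLike.star_def,
      Complex.conj_ofReal, smul_eq_mul, smul_eq_mul]
    field_simp

end PosSemidef

section PartialTranspose

variable {a b : Type*}

theorem partialTranspose_add (X Y : Matrix (a × b) (a × b) ℂ) :
    partialTranspose (X + Y) = partialTranspose X + partialTranspose Y := rfl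

theorem partialTranspose_sub (X Y : Matrix (a × b) (a × b) ℂ) :
    partialTranspose (X - Y) = partialTranspose X - partialTranspose Y := rfl

theorem partialTranspose_smul (c : ℂ) (X : Matrix (a × b) (a × b) ℂ) :
    partialTranspose (c • X) = c • partialTranspose X := rfl

theorem partialTranspose_sum {ι : Type*} (s : Finset ι) (X : ι → Matrix (a × b) (a × b) ℂ) :
    partialTranspose (∑ i ∈ s, X i) = ∑ i ∈ s, partialTranspose (X i) := by
  ext p q; simp [partialTranspose, Matrix.sum_apply]

theorem partialTranspose_kronecker (X : Matrix a a ℂ) (Y : Matrix b b ℂ) :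
    partialTranspose (X ⊗ₖ Y) = Xᵀ ⊗ₖ Y := rfl

theorem partialTranspose_one [DecidableEq a] [DecidableEq b] :
    partialTranspose (1 : Matrix (a × b) (a × b) ℂ) = 1 := by
  rw [← one_kronecker_one, partialTranspose_kronecker, transpose_one]

theorem partialTranspose_partialTranspose (X : Matrix (a × b) (a × b) ℂ) :
    partialTranspose (partialTranspose X) = X := rfl

theorem isHermitian_partialTranspose {X : Matrix (a × b) (a × b) ℂ} (h : X.IsHermitian) :
    (partialTranspose X).IsHermitian := by
  ext p q
  exact h.apply _ _

theorem partialTranspose_regroup_kronecker {a' b' : Type*} (X : Matrix (a × b) (a × b) ℂ)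
    (Y : Matrix (a' × b') (a' × b') ℂ) :
    partialTranspose (regroup (X ⊗ₖ Y)) = regroup (partialTranspose X ⊗ₖ partialTranspose Y) :=
  rfl

theorem trace_partialTranspose_mul [Fintype a] [Fintype b] (X Y : Matrix (a × b) (a × b) ℂ) :
    (partialTranspose X * Y).trace = (X * partialTranspose Y).trace := by
  simp only [Matrix.trace, diag_apply, Matrix.mul_apply, Fintype.sum_prod_type, partialTranspose,
    of_apply]
  rw [Finset.sum_comm]
  conv_rhs => rw [Finset.sum_comm]
  exact Finset.sum_congr rfl fun k _ => Finset.sum_comm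

end PartialTranspose

section Separable

variable {a b : Type*}

theorem IsSeparable.of_kronecker {τ : Matrix a a ℂ} {ω : Matrix b b ℂ}
    (hτ : τ.PosSemidef) (hω : ω.PosSemidef) : IsSeparable (τ ⊗ₖ ω) :=
  ⟨1, fun _ => τ, fun _ => ω, fun _ => hτ, fun _ => hω, by simp⟩

theorem IsSeparable.zero : IsSeparable (0 : Matrix (a × b) (a × b) ℂ) :=
  ⟨0, fun _ => 0, fun _ => 0, fun i => i.elim0, fun i => i.elim0, by simp⟩

theorem IsSeparable.one [DecidableEq a] [DecidableEq b] :
    IsSeparable (1 : Matrix (a × b) (a × b) ℂ) := by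
  rw [← one_kronecker_one]
  exact .of_kronecker PosSemidef.one PosSemidef.one

theorem IsSeparable.add {σ σ' : Matrix (a × b) (a × b) ℂ}
    (h : IsSeparable σ) (h' : IsSeparable σ') : IsSeparable (σ + σ') := by
  obtain ⟨n, τ, ω, hτ, hω, rfl⟩ := h
  obtain ⟨m, τ', ω', hτ', hω', rfl⟩ := h'
  refine ⟨n + m, Fin.append τ τ', Fin.append ω ω', ?_, ?_, ?_⟩
  · intro i; refine Fin.addCases (fun i => ?_) (fun i => ?_) i <;> simp [hτ, hτ']
  · intro i; refine Fin.addCases (fun i => ?_) (fun i => ?_) i <;> simp [hω, hω']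
  · simp [Fin.sum_univ_add]

theorem IsSeparable.smul {σ : Matrix (a × b) (a × b) ℂ}
    (h : IsSeparable σ) {c : ℂ} (hc : 0 ≤ c) : IsSeparable (c • σ) := by
  obtain ⟨n, τ, ω, hτ, hω, rfl⟩ := h
  exact ⟨n, fun i => c • τ i, ω, fun i => (hτ i).smul hc, hω, by
    simp [Finset.smul_sum, Matrix.smul_kronecker]⟩

theorem IsSeparable.sum {ι : Type*} {s : Finset ι} {σ : ι → Matrix (a × b) (a × b) ℂ}
    (h : ∀ i ∈ s, IsSeparable (σ i)) : IsSeparable (∑ i ∈ s, σ i) :=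
  Finset.sum_induction σ IsSeparable (fun _ _ => .add) .zero h

theorem IsSeparable.sum_symm {ι : Type*} {s : Finset ι} {σ : ι → ι → Matrix (a × b) (a × b) ℂ}
    (h : ∀ i j, IsSeparable (σ i j + σ j i)) : IsSeparable (∑ i ∈ s, ∑ j ∈ s, σ i j) := by
  have key : ∑ i ∈ s, ∑ j ∈ s, σ i j = (1 / 2 : ℂ) • ∑ i ∈ s, ∑ j ∈ s, (σ i j + σ j i) := by
    simp only [Finset.sum_add_distrib]
    rw [Finset.sum_comm (f := fun i j => σ j i)]
    module
  rw [key]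
  exact (IsSeparable.sum fun i _ => .sum fun j _ => h i j).smul (by positivity)

theorem IsSeparable.posSemidef [Finite a] [Finite b] {σ : Matrix (a × b) (a × b) ℂ}
    (h : IsSeparable σ) : σ.PosSemidef := by
  obtain ⟨n, τ, ω, hτ, hω, rfl⟩ := h
  exact posSemidef_sum _ fun i _ => (hτ i).kronecker (hω i)

theorem IsSeparable.partialTranspose {σ : Matrix (a × b) (a × b) ℂ} (h : IsSeparable σ) :
    IsSeparable (partialTranspose σ) := by
  obtain ⟨n, τ, ω, hτ, hω, rfl⟩ := h
  exact ⟨n, fun i => (τ i)ᵀ, ω, fun i => (hτ i).transpose, hω, by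
    simp only [partialTranspose_sum, partialTranspose_kronecker]⟩

theorem IsSeparable.trace_partialTranspose_mul_nonneg [Fintype a] [Fintype b]
    {P σ : Matrix (a × b) (a × b) ℂ} (hP : P.PosSemidef) (hσ : IsSeparable σ) :
    0 ≤ (QEnt.partialTranspose P * σ).trace := by
  rw [trace_partialTranspose_mul]
  exact trace_mul_nonneg hP hσ.partialTranspose.posSemidef

theorem isSeparable_kronecker_add_kronecker {P H : Matrix a a ℂ} {Q K : Matrix b b ℂ}
    (hadd : (P + H).PosSemidef) (hsub : (P - H).PosSemidef)
    (kadd : (Q + K).PosSemidef) (ksub : (Q - K).PosSemidef) :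
    IsSeparable (P ⊗ₖ Q + H ⊗ₖ K) := by
  have key : P ⊗ₖ Q + H ⊗ₖ K =
      (1 / 2 : ℂ) • ((P + H) ⊗ₖ (Q + K) + (P - H) ⊗ₖ (Q - K)) := by
    ext ⟨i, k⟩ ⟨j, l⟩
    simp only [Matrix.add_apply, Matrix.sub_apply, Matrix.smul_apply, kronecker_apply, smul_eq_mul]
    ring
  rw [key]
  exact ((IsSeparable.of_kronecker hadd kadd).add (.of_kronecker hsub ksub)).smul (by positivity)

/-- The Hermitian coherence `c|x⟩⟨y| + c̄|y⟩⟨x|` between two vectors. -/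
def coherence (c : ℂ) (x y : a → ℂ) : Matrix a a ℂ :=
  c • vecMulVec x (star y) + star c • vecMulVec y (star x)

theorem posSemidef_add_coherence [Finite a] {c : ℂ} (hc : c * star c = 1) (x y : a → ℂ) :
    (vecMulVec x (star x) + vecMulVec y (star y) + coherence c x y).PosSemidef := by
  convert posSemidef_vecMulVec_self_star (x + star c • y) using 1
  rw [star_add, star_smul, star_star, add_vecMulVec, vecMulVec_add, vecMulVec_add, smul_vecMulVec,
    smul_vecMulVec, vecMulVec_smul, vecMulVec_smul, smul_smul, mul_comm, hc, coherence]
  module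

theorem posSemidef_sub_coherence [Finite a] {c : ℂ} (hc : c * star c = 1) (x y : a → ℂ) :
    (vecMulVec x (star x) + vecMulVec y (star y) - coherence c x y).PosSemidef := by
  convert posSemidef_add_coherence (c := -c) (by rwa [star_neg, neg_mul_neg]) x y using 1
  rw [coherence, coherence, star_neg]
  module

theorem isSeparable_kronecker_add_coherence [Finite a] [Finite b] (x y : a → ℂ) (v w : b → ℂ) :
    IsSeparable ((vecMulVec x (star x) + vecMulVec y (star y)) ⊗ₖ
        (vecMulVec v (star v) + vecMulVec w (star w)) +
      (vecMulVec x (star y) ⊗ₖ vecMulVec v (star w) +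
        vecMulVec y (star x) ⊗ₖ vecMulVec w (star v))) := by
  have hphase {c : ℂ} (hc : c * star c = 1) :
      IsSeparable ((vecMulVec x (star x) + vecMulVec y (star y)) ⊗ₖ
          (vecMulVec v (star v) + vecMulVec w (star w)) +
        coherence c x y ⊗ₖ coherence (star c) v w) :=
    have hc' : star c * star (star c) = 1 := by rwa [star_star, mul_comm]
    isSeparable_kronecker_add_kronecker (posSemidef_add_coherence hc x y)
      (posSemidef_sub_coherence hc x y) (posSemidef_add_coherence hc' v w)
      (posSemidef_sub_coherence hc' v w)
  -- Averaging over the phases `c = 1` and `c = i` cancels the terms carrying `c²`.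
  convert ((hphase (c := 1) (by simp)).add (hphase (c := Complex.I) (by simp))).smul
    (c := 1 / 2) (by positivity) using 1
  ext ⟨i, k⟩ ⟨j, l⟩
  simp only [coherence, Matrix.add_apply, Matrix.smul_apply, kronecker_apply, vecMulVec_apply,
    smul_eq_mul, star_one, RCLike.star_def, Complex.conj_I, map_neg, neg_neg]
  linear_combination (1 / 2 : ℂ) * (x i * star y j - y i * star x j) *
    (v k * star w l - w k * star v l) * Complex.I_mul_I

end Separable

section RankOne

variable {a b : Type*}

theorem sum_kronecker {ι : Type*} (s : Finset ι) (X : ι → Matrix a a ℂ) (Y : Matrix b b ℂ) :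
    (∑ i ∈ s, X i) ⊗ₖ Y = ∑ i ∈ s, X i ⊗ₖ Y := by
  ext ⟨i, k⟩ ⟨j, l⟩
  simp only [kronecker_apply, Matrix.sum_apply, Finset.sum_mul]

variable [DecidableEq a]

theorem vecMulVec_eq_sum_single_kronecker [Fintype a] {η : a × b → ℂ} {r : a → ℝ} {u : a → b → ℂ}
    (h : ∀ i k, η (i, k) = r i * u i k) :
    vecMulVec η (star η) = ∑ i, ∑ j,
      ((r i : ℂ) * r j) • (Matrix.single i j (1 : ℂ) ⊗ₖ vecMulVec (u i) (star (u j))) := by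
  ext ⟨i, k⟩ ⟨j, l⟩
  simp only [vecMulVec_apply, Pi.star_apply, h, star_mul', RCLike.star_def, Complex.conj_ofReal,
    Matrix.sum_apply, Matrix.smul_apply, kronecker_apply, Matrix.single_apply, ite_and, ite_mul,
    one_mul, zero_mul, smul_eq_mul, mul_ite, mul_zero, Finset.sum_ite_eq', Finset.mem_univ, if_true,
    Finset.sum_ite_irrel, Finset.sum_const_zero]
  ring

theorem posSemidef_single [Finite a] (i : a) : (Matrix.single i i (1 : ℂ)).PosSemidef := by
  simpa only [← Pi.single_star, star_one, ← single_eq_single_vecMulVec_single] using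
    posSemidef_vecMulVec_self_star (Pi.single i (1 : ℂ))

theorem isSeparable_single_pair [Finite a] [Finite b] (i j : a) (s t e : ℝ) (he : e * e = 1)
    (v w : b → ℂ) :
    IsSeparable (((t : ℂ) ^ 2 • Matrix.single i i (1 : ℂ) + (s : ℂ) ^ 2 • Matrix.single j j 1) ⊗ₖ
        (vecMulVec v (star v) + vecMulVec w (star w)) +
      ((e : ℂ) * s * t) • (Matrix.single i j (1 : ℂ) ⊗ₖ vecMulVec v (star w) +
        Matrix.single j i (1 : ℂ) ⊗ₖ vecMulVec w (star v))) := by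
  have he' : (e : ℂ) * e = 1 := by exact_mod_cast he
  convert isSeparable_kronecker_add_coherence ((t : ℂ) • Pi.single i (1 : ℂ))
    ((e * s : ℂ) • Pi.single j (1 : ℂ)) v w using 1
  have hs : (e : ℂ) * s * (e * s) = (s : ℂ) ^ 2 := by linear_combination (s : ℂ) ^ 2 * he'
  simp only [star_smul, vecMulVec_smul, smul_vecMulVec, star_mul', RCLike.star_def,
    Complex.conj_ofReal, ← Pi.single_star, star_one, ← single_eq_single_vecMulVec_single,
    smul_smul, smul_kronecker, smul_add, hs, sq, mul_comm (t : ℂ)]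

theorem isSeparable_two_smul_one_add_smul_vecMulVec [Fintype a] [Fintype b] [DecidableEq b]
    (η : a × b → ℂ) {e : ℝ} (he : e * e = 1) :
    IsSeparable ((2 * (star η ⬝ᵥ η)) • 1 + (e : ℂ) • vecMulVec η (star η)) := by
  choose r u hη hr hu using fun i => exists_eq_smul_posSemidef_one_sub fun k => η (i, k)
  let E (i j : a) : Matrix a a ℂ := Matrix.single i j 1
  let U (i : a) : Matrix b b ℂ := vecMulVec (u i) (star (u i))
  let pair (i j : a) := (r j : ℂ) ^ 2 • (E i i ⊗ₖ (U i + U j)) +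
    ((e : ℂ) * r i * r j) • (E i j ⊗ₖ vecMulVec (u i) (star (u j)))
  let rest (i j : a) := (r j : ℂ) ^ 2 • (E i i ⊗ₖ ((1 - U i) + (1 - U j)))
  have norm_sq : star η ⬝ᵥ η = ∑ j, (r j : ℂ) ^ 2 := by
    simp only [hr, dotProduct, Pi.star_apply, Fintype.sum_prod_type]
  have sum_E : ∑ i, E i i ⊗ₖ (1 : Matrix b b ℂ) = 1 := by
    rw [← sum_kronecker, Matrix.sum_single_one, one_kronecker_one]
  have decomposition : (2 * (star η ⬝ᵥ η)) • 1 + (e : ℂ) • vecMulVec η (star η) =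
      ∑ i, ∑ j, pair i j + ∑ i, ∑ j, rest i j := by
    have pair_add_rest (i j : a) : pair i j + rest i j = (2 * (r j : ℂ) ^ 2) • (E i i ⊗ₖ 1) +
        (e : ℂ) • (((r i : ℂ) * r j) • (E i j ⊗ₖ vecMulVec (u i) (star (u j)))) := by
      have hU : U i + U j + ((1 - U i) + (1 - U j)) = (2 : ℂ) • 1 := by module
      rw [add_right_comm, ← smul_add, ← kronecker_add, hU, kronecker_smul]
      module
    simp only [← Finset.sum_add_distrib, pair_add_rest]
    simp only [Finset.sum_add_distrib, ← Finset.sum_smul, ← Finset.smul_sum, ← Finset.mul_sum,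
      sum_E, ← norm_sq]
    rw [vecMulVec_eq_sum_single_kronecker fun i k => congrFun (hη i) k]
  rw [decomposition]
  refine (IsSeparable.sum_symm fun i j => ?_).add (.sum fun i _ => .sum fun j _ => ?_)
  · convert isSeparable_single_pair i j (r i) (r j) e he (u i) (u j) using 1
    simp only [pair, E, U, add_kronecker, kronecker_add, smul_kronecker]
    module
  · exact (IsSeparable.of_kronecker (posSemidef_single i) ((hu i).add (hu j))).smul
      (by exact_mod_cast sq_nonneg (r j))

end RankOne

section Witness

variable {a b : Type*} [Fintype a] [Fintype b]

theorem exists_isNegativeUnitEigenvector {d : Type*} [Fintype d] {M : Matrix d d ℂ}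
    (hM : M.IsHermitian) (h : ¬ M.PosSemidef) : ∃ η, IsNegativeUnitEigenvector M η := by
  classical
  rw [hM.posSemidef_iff_eigenvalues_nonneg, Pi.le_def, not_forall] at h
  obtain ⟨i, hi⟩ := h
  refine ⟨hM.eigenvectorBasis i, ?_, hM.eigenvalues i, not_le.mp hi,
    hM.mulVec_eigenvectorBasis i⟩
  rw [dotProduct_comm, ← EuclideanSpace.inner_eq_star_dotProduct, inner_self_eq_norm_sq_to_K,
    hM.eigenvectorBasis.orthonormal.1 i, RCLike.ofReal_one, one_pow]

theorem trace_witness_mul (η : a × b → ℂ) (X : Matrix (a × b) (a × b) ℂ) :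
    (witness η * X).trace = star η ⬝ᵥ (partialTranspose X *ᵥ η) := by
  rw [witness, trace_partialTranspose_mul, vecMulVec_mul, trace_vecMulVec, dotProduct_comm,
    dotProduct_mulVec]

theorem trace_witness_mul_of_eigenvector {ρ : Matrix (a × b) (a × b) ℂ} {η : a × b → ℂ} {μ : ℂ}
    (hη : star η ⬝ᵥ η = 1) (hμ : partialTranspose ρ *ᵥ η = μ • η) :
    (witness η * ρ).trace = μ := by
  rw [trace_witness_mul, hμ, dotProduct_smul, hη, smul_eq_mul, mul_one]

theorem IsSeparable.trace_witness_mul_nonneg {σ : Matrix (a × b) (a × b) ℂ} (hσ : IsSeparable σ)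
    (η : a × b → ℂ) : 0 ≤ (witness η * σ).trace :=
  hσ.trace_partialTranspose_mul_nonneg (posSemidef_vecMulVec_self_star η)

variable [DecidableEq a] [DecidableEq b] {η : a × b → ℂ}

theorem isSeparable_two_smul_one_add_smul_witness (hη : star η ⬝ᵥ η = 1) {e : ℝ} (he : e * e = 1) :
    IsSeparable ((2 : ℂ) • 1 + (e : ℂ) • witness η) := by
  have h := (isSeparable_two_smul_one_add_smul_vecMulVec η he).partialTranspose
  rwa [partialTranspose_add, partialTranspose_smul, partialTranspose_smul, partialTranspose_one,
    hη, mul_one] at h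

theorem posSemidef_one_sub_witness (hη : star η ⬝ᵥ η = 1) : (1 - witness η).PosSemidef := by
  have hW : (witness η).IsHermitian :=
    isHermitian_partialTranspose (posSemidef_vecMulVec_self_star η).isHermitian
  have trace_sq : (witness η * witness η).trace = 1 := by
    rw [witness, trace_partialTranspose_mul, partialTranspose_partialTranspose,
      vecMulVec_mul_vecMulVec, hη, one_smul, trace_vecMulVec, dotProduct_comm, hη]
  have sq_posSemidef : (witness η * witness η).PosSemidef := by
    nth_rw 1 [← hW.eq]
    exact posSemidef_conjTranspose_mul_self _
  refine posSemidef_one_sub_of_sq hW ?_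
  simpa only [trace_sq, one_smul] using posSemidef_trace_smul_one_sub sq_posSemidef

theorem isSeparable_testOperator (hη : star η ⬝ᵥ η = 1) : IsSeparable (testOperator η) := by
  have h := isSeparable_two_smul_one_add_smul_witness hη (e := 1) (by norm_num)
  rw [Complex.ofReal_one, one_smul, add_comm] at h
  exact h.smul (by positivity)

omit [Fintype a] [Fintype b] in
theorem one_sub_testOperator (η : a × b → ℂ) :
    1 - testOperator η = (1 / 3 : ℂ) • (1 - witness η) := by
  rw [testOperator]
  module

theorem posSemidef_one_sub_testOperator (hη : star η ⬝ᵥ η = 1) :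
    (1 - testOperator η).PosSemidef := by
  rw [one_sub_testOperator]
  exact (posSemidef_one_sub_witness hη).smul (by positivity)

theorem trace_testOperator_mul (η : a × b → ℂ) (X : Matrix (a × b) (a × b) ℂ) :
    (testOperator η * X).trace = ((witness η * X).trace + 2 * X.trace) / 3 := by
  rw [testOperator, smul_mul_assoc, trace_smul, add_mul, trace_add, smul_mul_assoc, trace_smul,
    one_mul, smul_eq_mul, smul_eq_mul]
  ring

end Witness

section PhiPlus

theorem phiPlus_apply (d : ℕ) (p q : Fin d × Fin d) :
    phiPlus d p q = if p.1 = p.2 ∧ q.1 = q.2 then (d : ℂ)⁻¹ else 0 := by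
  have h : ((1 / √d : ℝ) : ℂ) * ((1 / √d : ℝ) : ℂ) = (d : ℂ)⁻¹ := by
    rw [← Complex.ofReal_mul, div_mul_div_comm, Real.mul_self_sqrt d.cast_nonneg, one_mul,
      one_div, Complex.ofReal_inv, Complex.ofReal_natCast]
  simp only [phiPlus, vecMulVec_apply, phiPlusVec, Pi.star_apply, apply_ite star, star_zero,
    RCLike.star_def, Complex.conj_ofReal, ite_mul, mul_ite, zero_mul, mul_zero, h, ite_and]
  split_ifs <;> rfl

theorem posSemidef_phiPlus (d : ℕ) : (phiPlus d).PosSemidef := posSemidef_vecMulVec_self_star _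

variable {d : ℕ}

theorem trace_phiPlus (hd : d ≠ 0) : (phiPlus d).trace = 1 := by
  simp [Matrix.trace, Fintype.sum_prod_type, phiPlus_apply, hd]

theorem phiPlus_mul_phiPlus (hd : d ≠ 0) : phiPlus d * phiPlus d = phiPlus d := by
  have hunit : star (phiPlusVec d) ⬝ᵥ phiPlusVec d = 1 := by
    rw [dotProduct_comm, ← trace_vecMulVec]
    exact trace_phiPlus hd
  rw [phiPlus, vecMulVec_mul_vecMulVec, hunit, one_smul]

theorem isHermitian_partialTranspose_smul_phiPlus (d : ℕ) :
    (partialTranspose ((d : ℂ) • phiPlus d)).IsHermitian :=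
  isHermitian_partialTranspose ((posSemidef_phiPlus d).smul (Nat.cast_nonneg d)).isHermitian

theorem partialTranspose_smul_phiPlus_mul_self (hd : d ≠ 0) :
    partialTranspose ((d : ℂ) • phiPlus d) * partialTranspose ((d : ℂ) • phiPlus d) = 1 := by
  ext ⟨i, k⟩ ⟨j, l⟩
  simp only [partialTranspose, Matrix.smul_apply, phiPlus_apply, ite_and, smul_eq_mul, mul_ite,
    ne_eq, Nat.cast_eq_zero, hd, not_false_eq_true, mul_inv_cancel₀, mul_zero, Matrix.mul_apply,
    of_apply, mul_one, Fintype.sum_prod_type, Finset.sum_ite_eq, Finset.mem_univ, if_true,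
    Finset.sum_ite_eq', Matrix.one_apply, Prod.mk.injEq]
  split_ifs <;> simp_all

theorem IsSeparable.mul_trace_phiPlus_mul_le (hd : d ≠ 0)
    {σ : Matrix (Fin d × Fin d) (Fin d × Fin d) ℂ} (hσ : IsSeparable σ) :
    d * (phiPlus d * σ).trace ≤ σ.trace := by
  have h := hσ.trace_partialTranspose_mul_nonneg (posSemidef_one_sub_of_involution
    (isHermitian_partialTranspose_smul_phiPlus d) (partialTranspose_smul_phiPlus_mul_self hd))
  rwa [partialTranspose_sub, partialTranspose_partialTranspose, partialTranspose_one, sub_mul,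
    one_mul, trace_sub, smul_mul_assoc, trace_smul, smul_eq_mul, sub_nonneg] at h

theorem isSeparable_one_add_two_smul_phiPlus_two :
    IsSeparable (1 + (2 : ℂ) • phiPlus 2) := by
  let e (i : Fin 2) : Fin 2 → ℂ := Pi.single i 1
  convert ((IsSeparable.of_kronecker (posSemidef_single 0) (posSemidef_single 0)).add
    (.of_kronecker (posSemidef_single 1) (posSemidef_single 1))).add
    (isSeparable_kronecker_add_coherence (e 0) (e 1) (e 0) (e 1)) using 1
  ext ⟨i, k⟩ ⟨j, l⟩
  fin_cases i <;> fin_cases j <;> fin_cases k <;> fin_cases l <;>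
    simp [e, vecMulVec_apply, phiPlus_apply]

end PhiPlus

section Isotropic

/-- The two-qubit isotropic operators, parametrised so that `isotropic x y` has weight `y` on each
of the two coherences `|00⟩⟨11|` and `|11⟩⟨00|`, against white noise of weight `x` on each basis
vector. -/
def isotropic (x y : ℂ) : Matrix (Fin 2 × Fin 2) (Fin 2 × Fin 2) ℂ :=
  x • 1 + (2 * y) • phiPlus 2

theorem trace_isotropic (x y : ℂ) : (isotropic x y).trace = 4 * x + 2 * y := by
  simp [isotropic, trace_phiPlus, mul_comm x]

theorem trace_phiPlus_mul_isotropic (x y : ℂ) :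
    (phiPlus 2 * isotropic x y).trace = x + 2 * y := by
  rw [isotropic, Matrix.mul_add, Matrix.mul_smul, Matrix.mul_smul, Matrix.mul_one,
    phiPlus_mul_phiPlus two_ne_zero, trace_add, trace_smul, trace_smul, trace_phiPlus two_ne_zero,
    smul_eq_mul, smul_eq_mul, mul_one, mul_one]

theorem posSemidef_isotropic {x y : ℂ} (hx : 0 ≤ x) (hy : 0 ≤ y) :
    (isotropic x y).PosSemidef :=
  (PosSemidef.one.smul hx).add ((posSemidef_phiPlus 2).smul (mul_nonneg zero_le_two hy))

theorem isState_isotropic {x y : ℝ} (hx : 0 ≤ x) (hy : 0 ≤ y) (h : 4 * x + 2 * y = 1) :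
    IsState (isotropic x y) :=
  ⟨posSemidef_isotropic (Complex.zero_le_real.mpr hx) (Complex.zero_le_real.mpr hy), by
    rw [trace_isotropic]
    exact_mod_cast h⟩

theorem isSeparable_isotropic {x y : ℂ} (hy : 0 ≤ y) (hyx : y ≤ x) :
    IsSeparable (isotropic x y) := by
  have key : isotropic x y = (x - y) • 1 + y • (1 + (2 : ℂ) • phiPlus 2) := by
    rw [isotropic]; module
  rw [key]
  exact (IsSeparable.one.smul (sub_nonneg.mpr hyx)).add
    (isSeparable_one_add_two_smul_phiPlus_two.smul hy)

theorem IsSeparable.le_of_isotropic {x y : ℂ} (h : IsSeparable (isotropic x y)) : y ≤ x := by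
  have h2 := h.mul_trace_phiPlus_mul_le two_ne_zero
  rw [trace_isotropic, trace_phiPlus_mul_isotropic] at h2
  rw [← sub_nonneg]
  convert mul_nonneg (a := (1 / 2 : ℂ)) (by positivity) (sub_nonneg.mpr h2) using 1
  push_cast
  ring

end Isotropic

section CompletelyPositive

theorem linearMap_ext_kronecker {a b M : Type*} [Finite a] [Finite b] [AddCommMonoid M]
    [Module ℂ M] {f g : Matrix (a × b) (a × b) ℂ →ₗ[ℂ] M}
    (h : ∀ X Y, f (X ⊗ₖ Y) = g (X ⊗ₖ Y)) : f = g := by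
  classical
  have := Fintype.ofFinite a
  have := Fintype.ofFinite b
  have hcomp : f ∘ₗ (kroneckerLinearEquiv a a b b ℂ).toLinearMap =
      g ∘ₗ (kroneckerLinearEquiv a a b b ℂ).toLinearMap :=
    TensorProduct.ext' fun X Y => by simpa using h X Y
  ext1 X
  obtain ⟨Z, rfl⟩ := (kroneckerLinearEquiv a a b b ℂ).surjective X
  exact LinearMap.congr_fun hcomp Z

/-- The completely positive map `X ↦ V X Vᴴ` with a single Kraus operator `V`. -/
def conjMap {d d' : Type*} [Fintype d] (V : Matrix d' d ℂ) :
    Matrix d d ℂ →ₗ[ℂ] Matrix d' d' ℂ where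
  toFun X := V * X * Vᴴ
  map_add' X Y := by rw [Matrix.mul_add, Matrix.add_mul]
  map_smul' c X := by rw [Matrix.mul_smul, Matrix.smul_mul, RingHom.id_apply]

/-- The measure-and-prepare map `X ↦ Tr(A X) B`. -/
def prepareMap {d d' : Type*} [Fintype d] (A : Matrix d d ℂ) (B : Matrix d' d' ℂ) :
    Matrix d d ℂ →ₗ[ℂ] Matrix d' d' ℂ where
  toFun X := (A * X).trace • B
  map_add' X Y := by rw [Matrix.mul_add, trace_add, add_smul]
  map_smul' c X := by rw [Matrix.mul_smul, trace_smul, smul_assoc, RingHom.id_apply]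

theorem conjMap_apply {d d' : Type*} [Fintype d] (V : Matrix d' d ℂ) (X : Matrix d d ℂ) :
    conjMap V X = V * X * Vᴴ := rfl

theorem prepareMap_apply {d d' : Type*} [Fintype d] (A : Matrix d d ℂ) (B : Matrix d' d' ℂ)
    (X : Matrix d d ℂ) : prepareMap A B X = (A * X).trace • B := rfl

theorem trace_conjMap {d d' : Type*} [Fintype d] [Fintype d'] (V : Matrix d' d ℂ)
    (X : Matrix d d ℂ) : (conjMap V X).trace = (Vᴴ * V * X).trace := by
  rw [conjMap_apply, Matrix.trace_mul_comm, Matrix.mul_assoc]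

theorem conjMap_one {d : Type*} [Fintype d] [DecidableEq d] :
    conjMap (1 : Matrix d d ℂ) = LinearMap.id := by
  ext1 X
  rw [conjMap_apply, conjTranspose_one, Matrix.one_mul, Matrix.mul_one, LinearMap.id_apply]

theorem conjMap_mul {c d d' : Type*} [Fintype c] [Fintype d] (U : Matrix d' c ℂ)
    (V : Matrix c d ℂ) (X : Matrix d d ℂ) : conjMap (U * V) X = conjMap U (conjMap V X) := by
  simp only [conjMap_apply, conjTranspose_mul, Matrix.mul_assoc]

theorem conjMap_submatrix_one {d d' : Type*} [Fintype d] [DecidableEq d] (g : d' → d)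
    (X : Matrix d d ℂ) : conjMap ((1 : Matrix d d ℂ).submatrix g id) X = X.submatrix g g := by
  ext i j
  simp [conjMap_apply, Matrix.mul_apply, Matrix.one_apply]

theorem conjMap_submatrix_reindex {c d d' : Type*} [Fintype d] [Fintype d'] (V : Matrix c d ℂ)
    (e : d ≃ d') (X : Matrix d d ℂ) :
    conjMap (V.submatrix id e.symm) (reindex e e X) = conjMap V X := by
  rw [conjMap_apply, conjMap_apply, conjTranspose_submatrix, reindex_apply, submatrix_mul_equiv,
    submatrix_mul_equiv, submatrix_id_id]

theorem one_submatrix_kronecker_one_submatrix {a b c e : Type*} [DecidableEq a] [DecidableEq b]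
    (f : c → a) (g : e → b) :
    (1 : Matrix a a ℂ).submatrix f id ⊗ₖ (1 : Matrix b b ℂ).submatrix g id =
      (1 : Matrix (a × b) (a × b) ℂ).submatrix (Prod.map f g) id := by
  rw [← one_kronecker_one]
  rfl

variable {a b a' b' : Type*} [Fintype a] [DecidableEq a] [Fintype b] [DecidableEq b]
  [Fintype a'] [DecidableEq a'] [Fintype b'] [DecidableEq b']

theorem tensorMap_conjMap (V : Matrix a' a ℂ) (U : Matrix b' b ℂ) :
    tensorMap (conjMap V) (conjMap U) = conjMap (V ⊗ₖ U) :=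
  linearMap_ext_kronecker fun X Y => by
    simp only [tensorMap_kronecker, conjMap_apply, conjTranspose_kronecker, ← mul_kronecker_mul]

theorem tensorMap_comp_tensorMap {a'' b'' : Type*} [Fintype a''] [DecidableEq a''] [Fintype b'']
    [DecidableEq b''] (Φ' : Matrix a' a' ℂ →ₗ[ℂ] Matrix a'' a'' ℂ)
    (Ψ' : Matrix b' b' ℂ →ₗ[ℂ] Matrix b'' b'' ℂ) (Φ : Matrix a a ℂ →ₗ[ℂ] Matrix a' a' ℂ)
    (Ψ : Matrix b b ℂ →ₗ[ℂ] Matrix b' b' ℂ) :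
    tensorMap Φ' Ψ' ∘ₗ tensorMap Φ Ψ = tensorMap (Φ' ∘ₗ Φ) (Ψ' ∘ₗ Ψ) :=
  linearMap_ext_kronecker fun X Y => by
    simp only [LinearMap.comp_apply, tensorMap_kronecker]

theorem tensorMap_sum_right {ι : Type*} (s : Finset ι) (Φ : Matrix a a ℂ →ₗ[ℂ] Matrix a' a' ℂ)
    (Ψ : ι → Matrix b b ℂ →ₗ[ℂ] Matrix b' b' ℂ) :
    tensorMap Φ (∑ i ∈ s, Ψ i) = ∑ i ∈ s, tensorMap Φ (Ψ i) :=
  linearMap_ext_kronecker fun X Y => by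
    ext ⟨i, k⟩ ⟨j, l⟩
    simp only [LinearMap.sum_apply, tensorMap_kronecker, kronecker_apply, Matrix.sum_apply,
      Finset.mul_sum]

theorem isCompletelyPositive_conjMap (V : Matrix a' a ℂ) : IsCompletelyPositive (conjMap V) := by
  intro k M hM
  rw [← conjMap_one, tensorMap_conjMap]
  exact hM.mul_mul_conjTranspose_same _

theorem IsCompletelyPositive.sum {ι : Type*} {s : Finset ι}
    {Φ : ι → Matrix a a ℂ →ₗ[ℂ] Matrix a' a' ℂ} (h : ∀ i ∈ s, IsCompletelyPositive (Φ i)) :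
    IsCompletelyPositive (∑ i ∈ s, Φ i) := by
  intro k M hM
  rw [tensorMap_sum_right, LinearMap.sum_apply]
  exact posSemidef_sum s fun i hi => h i hi k M hM

theorem IsCompletelyPositive.add {Φ Ψ : Matrix a a ℂ →ₗ[ℂ] Matrix a' a' ℂ}
    (hΦ : IsCompletelyPositive Φ) (hΨ : IsCompletelyPositive Ψ) :
    IsCompletelyPositive (Φ + Ψ) := by
  have h := IsCompletelyPositive.sum (s := Finset.univ) (Φ := ![Φ, Ψ])
    (by simpa [Fin.forall_fin_two] using ⟨hΦ, hΨ⟩)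
  rwa [Fin.sum_univ_two] at h

theorem IsCompletelyPositive.comp {c : Type*} [Fintype c] [DecidableEq c]
    {Ψ : Matrix a' a' ℂ →ₗ[ℂ] Matrix c c ℂ} {Φ : Matrix a a ℂ →ₗ[ℂ] Matrix a' a' ℂ}
    (hΨ : IsCompletelyPositive Ψ) (hΦ : IsCompletelyPositive Φ) :
    IsCompletelyPositive (Ψ ∘ₗ Φ) := by
  intro k M hM
  rw [← LinearMap.id_comp LinearMap.id, ← tensorMap_comp_tensorMap]
  exact hΨ k _ (hΦ k M hM)

theorem prepareMap_one_one :
    prepareMap (1 : Matrix a a ℂ) (1 : Matrix a' a' ℂ) =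
      ∑ i, ∑ j, conjMap (Matrix.single i j (1 : ℂ)) := by
  ext1 X
  simp only [LinearMap.sum_apply, conjMap_apply, prepareMap_apply, conjTranspose_single, star_one,
    single_mul_mul_single, one_mul, mul_one]
  ext k l
  simp [Matrix.sum_apply, Matrix.single_apply, Matrix.one_apply, Matrix.trace, ite_and]

theorem isCompletelyPositive_prepareMap {A : Matrix a a ℂ} {B : Matrix a' a' ℂ}
    (hA : A.PosSemidef) (hB : B.PosSemidef) : IsCompletelyPositive (prepareMap A B) := by
  obtain ⟨S, rfl⟩ := exists_eq_conjTranspose_mul_self hA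
  obtain ⟨T, rfl⟩ := exists_eq_conjTranspose_mul_self hB
  have key : prepareMap (Sᴴ * S) (Tᴴ * T) = conjMap Tᴴ ∘ₗ prepareMap 1 1 ∘ₗ conjMap S := by
    ext1 X
    simp only [LinearMap.comp_apply, prepareMap_apply, Matrix.one_mul, trace_conjMap,
      conjMap_apply Tᴴ, Matrix.mul_smul, Matrix.smul_mul, Matrix.mul_one,
      conjTranspose_conjTranspose]
  rw [key, prepareMap_one_one]
  exact (isCompletelyPositive_conjMap _).comp
    ((IsCompletelyPositive.sum fun i _ => .sum fun j _ => isCompletelyPositive_conjMap _).comp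
      (isCompletelyPositive_conjMap S))

theorem isChannel_prepareMap_one {B : Matrix a' a' ℂ} (hB : IsState B) :
    IsChannel (prepareMap (1 : Matrix a a ℂ) B) :=
  ⟨isCompletelyPositive_prepareMap PosSemidef.one hB.1, fun X => by
    rw [prepareMap_apply, trace_smul, hB.2, Matrix.one_mul, smul_eq_mul, mul_one]⟩

end CompletelyPositive

section DualAndChoi

variable {d d' : Type*} [DecidableEq d]

theorem dualMap_add [Fintype d'] (Φ Ψ : Matrix d d ℂ →ₗ[ℂ] Matrix d' d' ℂ) :
    dualMap (Φ + Ψ) = dualMap Φ + dualMap Ψ := by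
  ext Y i j
  simp only [dualMap, LinearMap.coe_mk, AddHom.coe_mk, LinearMap.add_apply, of_apply,
    Matrix.add_apply, add_mul, trace_add]

variable [Fintype d]

theorem choi_add (Φ Ψ : Matrix d d ℂ →ₗ[ℂ] Matrix d' d' ℂ) :
    choi (Φ + Ψ) = choi Φ + choi Ψ := by
  simp only [choi, LinearMap.add_apply, add_kronecker, Finset.sum_add_distrib]

theorem dualMap_prepareMap [Fintype d'] (A : Matrix d d ℂ) (B : Matrix d' d' ℂ) :
    dualMap (prepareMap A B) = prepareMap B A := by
  ext Y i j
  simp only [dualMap, LinearMap.coe_mk, AddHom.coe_mk, of_apply, prepareMap_apply,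
    trace_mul_single, MulOpposite.op_one, one_smul, smul_mul_assoc, trace_smul, smul_eq_mul,
    Matrix.smul_apply, mul_comm]

theorem choi_prepareMap (A : Matrix d d ℂ) (B : Matrix d' d' ℂ) :
    choi (prepareMap A B) = B ⊗ₖ Aᵀ := by
  simp only [choi, prepareMap_apply, trace_mul_single, MulOpposite.op_one, one_smul, smul_kronecker]
  ext ⟨i, k⟩ ⟨j, l⟩
  simp [Matrix.sum_apply, Matrix.single_apply, ite_and, mul_comm]

end DualAndChoi

section MeasurePrepare

variable {d : Type*} [Fintype d] [DecidableEq d]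

theorem measurePrepare_eq_add (A : Matrix d d ℂ) :
    measurePrepare A = prepareMap A ((1 / 4 : ℂ) • 1) + prepareMap (1 - A) (phiPlus 2) := rfl

theorem dualMap_measurePrepare (A : Matrix d d ℂ) : dualMap (measurePrepare A) =
    prepareMap ((1 / 4 : ℂ) • 1) A + prepareMap (phiPlus 2) (1 - A) := by
  rw [measurePrepare_eq_add, dualMap_add, dualMap_prepareMap, dualMap_prepareMap]

theorem measurePrepare_eq_isotropic (A X : Matrix d d ℂ) :
    measurePrepare A X = isotropic ((A * X).trace / 4) (((1 - A) * X).trace / 2) := by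
  rw [measurePrepare_eq_add, LinearMap.add_apply, prepareMap_apply, prepareMap_apply, isotropic]
  module

variable {A : Matrix d d ℂ}

theorem isCompletelyPositive_measurePrepare (hA : A.PosSemidef) (hA' : (1 - A).PosSemidef) :
    IsCompletelyPositive (measurePrepare A) := by
  rw [measurePrepare_eq_add]
  exact (isCompletelyPositive_prepareMap hA (PosSemidef.one.smul (by positivity))).add
    (isCompletelyPositive_prepareMap hA' (posSemidef_phiPlus 2))

theorem isCompletelyPositive_dualMap_measurePrepare (hA : A.PosSemidef)
    (hA' : (1 - A).PosSemidef) : IsCompletelyPositive (dualMap (measurePrepare A)) := by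
  rw [dualMap_measurePrepare]
  exact (isCompletelyPositive_prepareMap (PosSemidef.one.smul (by positivity)) hA).add
    (isCompletelyPositive_prepareMap (posSemidef_phiPlus 2) hA')

theorem isTracePreserving_measurePrepare (A : Matrix d d ℂ) :
    IsTracePreserving (measurePrepare A) := by
  intro X
  rw [measurePrepare_eq_isotropic, trace_isotropic, sub_mul, trace_sub, one_mul]
  ring

theorem isChannel_measurePrepare (hA : A.PosSemidef) (hA' : (1 - A).PosSemidef) :
    IsChannel (measurePrepare A) :=
  ⟨isCompletelyPositive_measurePrepare hA hA', isTracePreserving_measurePrepare A⟩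

end MeasurePrepare

section TestOperator

variable {a b : Type*} [Fintype a] [Fintype b] [DecidableEq a] [DecidableEq b] {η : a × b → ℂ}

theorem isChannel_measurePrepare_testOperator (hη : star η ⬝ᵥ η = 1) :
    IsChannel (measurePrepare (testOperator η)) :=
  isChannel_measurePrepare (isSeparable_testOperator hη).posSemidef
    (posSemidef_one_sub_testOperator hη)

theorem measurePrepare_testOperator_apply (η : a × b → ℂ) (X : Matrix (a × b) (a × b) ℂ) :
    measurePrepare (testOperator η) X =
      isotropic (((witness η * X).trace + 2 * X.trace) / 12)
        ((X.trace - (witness η * X).trace) / 6) := by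
  rw [measurePrepare_eq_isotropic, sub_mul, trace_sub, one_mul, trace_testOperator_mul]
  congr 1 <;> ring

theorem measurePrepare_testOperator_of_eigenvector {ρ : Matrix (a × b) (a × b) ℂ}
    (hρ : IsState ρ) (hη : star η ⬝ᵥ η = 1) {μ : ℝ}
    (hμ : partialTranspose ρ *ᵥ η = (μ : ℂ) • η) :
    -2 ≤ μ ∧ measurePrepare (testOperator η) ρ =
      isotropic (((μ + 2) / 12 : ℝ) : ℂ) (((1 - μ) / 6 : ℝ) : ℂ) := by
  have hW := trace_witness_mul_of_eigenvector hη hμ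
  constructor
  · have h := trace_mul_nonneg (isSeparable_testOperator hη).posSemidef hρ.1
    rw [trace_testOperator_mul, hW, hρ.2] at h
    have h' : 0 ≤ (μ + 2 * 1) / 3 := by exact_mod_cast h
    linarith
  · rw [measurePrepare_testOperator_apply, hW, hρ.2]
    push_cast
    rw [mul_one]

theorem isNonEntangling_measurePrepare_testOperator (hη : star η ⬝ᵥ η = 1) :
    IsNonEntangling (measurePrepare (testOperator η)) := by
  refine ⟨(isChannel_measurePrepare_testOperator hη).1, fun σ hσ => ?_⟩
  rw [measurePrepare_testOperator_apply]
  refine isSeparable_isotropic ?_ ?_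
  · convert mul_nonneg (a := (1 / 6 : ℂ)) (by positivity)
      (trace_mul_nonneg (posSemidef_one_sub_witness hη) hσ.posSemidef) using 1
    rw [sub_mul, trace_sub, one_mul]
    ring
  · rw [← sub_nonneg]
    convert mul_nonneg (a := (1 / 4 : ℂ)) (by positivity) (hσ.trace_witness_mul_nonneg η) using 1
    ring

theorem isNonEntangling_dualMap_measurePrepare_testOperator (hη : star η ⬝ᵥ η = 1) :
    IsNonEntangling (dualMap (measurePrepare (testOperator η))) := by
  have hA := isSeparable_testOperator hη
  refine ⟨isCompletelyPositive_dualMap_measurePrepare hA.posSemidef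
    (posSemidef_one_sub_testOperator hη), fun σ hσ => ?_⟩
  have key : dualMap (measurePrepare (testOperator η)) σ =
      ((1 / 4 : ℂ) * (σ.trace - 2 * (phiPlus 2 * σ).trace)) • testOperator η +
      ((1 / 6 : ℂ) * (phiPlus 2 * σ).trace) •
        (((2 : ℂ) • 1 + ((-1 : ℝ) : ℂ) • witness η) + (2 : ℂ) • 1) := by
    rw [dualMap_measurePrepare, LinearMap.add_apply, prepareMap_apply, prepareMap_apply,
      smul_mul_assoc, one_mul, trace_smul, smul_eq_mul, testOperator]
    push_cast
    module
  have trace_le := hσ.mul_trace_phiPlus_mul_le two_ne_zero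
  have overlap_nonneg := trace_mul_nonneg (posSemidef_phiPlus 2) hσ.posSemidef
  rw [key]
  exact (hA.smul (mul_nonneg (by positivity) (sub_nonneg.mpr (by exact_mod_cast trace_le)))).add
    (((isSeparable_two_smul_one_add_smul_witness hη (by norm_num)).add
      (IsSeparable.one.smul zero_le_two)).smul (mul_nonneg (by positivity) overlap_nonneg))

theorem partialTranspose_regroup_choi_measurePrepare (A : Matrix (a × b) (a × b) ℂ) :
    partialTranspose (regroup (choi (measurePrepare A))) =
      regroup ((1 / 4 : ℂ) • (1 ⊗ₖ partialTranspose Aᵀ) +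
        partialTranspose (phiPlus 2) ⊗ₖ (1 - partialTranspose Aᵀ)) := by
  have regroup_add (X Y : Matrix ((Fin 2 × Fin 2) × (a × b)) ((Fin 2 × Fin 2) × (a × b)) ℂ) :
    regroup (X + Y) = regroup X + regroup Y := rfl
  rw [measurePrepare_eq_add, choi_add, choi_prepareMap, choi_prepareMap, regroup_add,
    partialTranspose_add, partialTranspose_regroup_kronecker, partialTranspose_regroup_kronecker,
    partialTranspose_smul, partialTranspose_one, transpose_sub, transpose_one,
    partialTranspose_sub, partialTranspose_one, smul_kronecker, regroup_add]

omit [Fintype a] [Fintype b] in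
theorem partialTranspose_transpose_testOperator (η : a × b → ℂ) :
    partialTranspose (testOperator η)ᵀ =
      (1 / 3 : ℂ) • ((vecMulVec η (star η))ᵀ + (2 : ℂ) • 1) := by
  rw [testOperator, transpose_smul, transpose_add, transpose_smul, transpose_one,
    partialTranspose_smul, partialTranspose_add, partialTranspose_smul, partialTranspose_one]
  rfl

theorem isPPTMap_measurePrepare_testOperator (hη : star η ⬝ᵥ η = 1) :
    IsPPTMap (measurePrepare (testOperator η)) := by
  refine ⟨(isChannel_measurePrepare_testOperator hη).1, ?_⟩
  set E := (vecMulVec η (star η))ᵀ with hE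
  have E_nonneg : E.PosSemidef := (posSemidef_vecMulVec_self_star η).transpose
  have one_sub_E_nonneg : (1 - E).PosSemidef := by
    have h := (posSemidef_one_sub_vecMulVec hη).transpose
    rwa [transpose_sub, transpose_one] at h
  have one_add_swap_nonneg : (1 + partialTranspose ((2 : ℂ) • phiPlus 2)).PosSemidef := by
    exact_mod_cast posSemidef_one_add_of_involution (isHermitian_partialTranspose_smul_phiPlus 2)
      (partialTranspose_smul_phiPlus_mul_self two_ne_zero)
  have key : (1 / 4 : ℂ) • ((1 : Matrix (Fin 2 × Fin 2) (Fin 2 × Fin 2) ℂ) ⊗ₖ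
        partialTranspose (testOperator η)ᵀ) +
      partialTranspose (phiPlus 2) ⊗ₖ (1 - partialTranspose (testOperator η)ᵀ) =
      (1 / 6 : ℂ) • ((1 + partialTranspose ((2 : ℂ) • phiPlus 2)) ⊗ₖ (1 - E)) +
        (1 / 4 : ℂ) • (1 ⊗ₖ E) := by
    rw [partialTranspose_transpose_testOperator, partialTranspose_smul, ← hE]
    ext ⟨p, q⟩ ⟨p', q'⟩
    simp only [kronecker_apply, Matrix.add_apply, Matrix.sub_apply, Matrix.smul_apply, smul_eq_mul]
    ring
  rw [partialTranspose_regroup_choi_measurePrepare, key]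
  exact (((one_add_swap_nonneg.kronecker one_sub_E_nonneg).smul (by positivity)).add
    ((PosSemidef.one.kronecker E_nonneg).smul (by positivity))).submatrix _

end TestOperator

section KrausInstruments

variable {d d' ι : Type*} [Fintype d] [DecidableEq d] [Fintype d'] [DecidableEq d'] [Fintype ι]

theorem isInstrument_conjMap {V : ι → Matrix d' d ℂ} (hV : ∑ x, (V x)ᴴ * V x = 1) :
    IsInstrument fun x => conjMap (V x) :=
  ⟨fun x => isCompletelyPositive_conjMap (V x), fun X => by
    simp only [LinearMap.sum_apply, trace_sum, trace_conjMap]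
    rw [← trace_sum, ← Finset.sum_mul, hV, Matrix.one_mul]⟩

theorem IsInstrument.isChannel_sum {E : ι → (Matrix d d ℂ →ₗ[ℂ] Matrix d' d' ℂ)}
    (hE : IsInstrument E) : IsChannel (∑ x, E x) :=
  ⟨IsCompletelyPositive.sum fun x _ => hE.1 x, hE.2⟩

theorem IsChannel.isInstrument {Φ : Matrix d d ℂ →ₗ[ℂ] Matrix d' d' ℂ} (h : IsChannel Φ) :
    IsInstrument fun _ : Unit => Φ :=
  ⟨fun _ => h.1, by rw [Fintype.sum_unique]; exact h.2⟩

omit [DecidableEq d'] in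
theorem exists_kraus_of_contraction [Nonempty d'] {K : Matrix d' d ℂ}
    (hK : (1 - Kᴴ * K).PosSemidef) :
    ∃ k : Option d → Matrix d' d ℂ, ∑ x, (k x)ᴴ * k x = 1 ∧ k none = K := by
  classical
  obtain ⟨S, hS⟩ := exists_eq_conjTranspose_mul_self hK
  let c : d' := Classical.arbitrary d'
  let P (i : d) : Matrix d' d ℂ := Matrix.single c i 1
  refine ⟨fun x => x.elim K fun i => P i * S, ?_, rfl⟩
  have complement : ∑ i, (P i * S)ᴴ * (P i * S) = Sᴴ * S := by
    have summand (i : d) : (P i * S)ᴴ * (P i * S) = Sᴴ * Matrix.single i i 1 * S := by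
      rw [conjTranspose_mul, Matrix.mul_assoc, ← Matrix.mul_assoc (P i)ᴴ, conjTranspose_single,
        star_one, single_mul_single_same, mul_one, ← Matrix.mul_assoc]
    simp only [summand, ← Finset.sum_mul, ← Finset.mul_sum, sum_single_one, Matrix.mul_one]
  rw [Fintype.sum_option]
  simp only [Option.elim]
  rw [complement, ← hS, add_sub_cancel]

end KrausInstruments

section TensorProducts

variable {a b a' b' : Type*} [Fintype a] [DecidableEq a] [Fintype b] [DecidableEq b]
  [Fintype a'] [DecidableEq a'] [Fintype b'] [DecidableEq b']

theorem tensorMap_sum_sum {ι κ : Type*} (s : Finset ι) (t : Finset κ)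
    (Φ : ι → Matrix a a ℂ →ₗ[ℂ] Matrix a' a' ℂ) (Ψ : κ → Matrix b b ℂ →ₗ[ℂ] Matrix b' b' ℂ) :
    tensorMap (∑ i ∈ s, Φ i) (∑ j ∈ t, Ψ j) = ∑ i ∈ s, ∑ j ∈ t, tensorMap (Φ i) (Ψ j) := by
  simp only [tensorMap_sum_right]
  rw [Finset.sum_comm]
  refine Finset.sum_congr rfl fun j _ => linearMap_ext_kronecker fun X Y => ?_
  simp only [LinearMap.sum_apply, tensorMap_kronecker, sum_kronecker]

theorem IsTracePreserving.tensorMap {Φ : Matrix a a ℂ →ₗ[ℂ] Matrix a' a' ℂ}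
    {Ψ : Matrix b b ℂ →ₗ[ℂ] Matrix b' b' ℂ} (hΦ : IsTracePreserving Φ)
    (hΨ : IsTracePreserving Ψ) : IsTracePreserving (tensorMap Φ Ψ) := by
  have h : traceLinearMap (a' × b') ℂ ℂ ∘ₗ QEnt.tensorMap Φ Ψ = traceLinearMap (a × b) ℂ ℂ :=
    linearMap_ext_kronecker fun X Y => by
      simp only [LinearMap.comp_apply, tensorMap_kronecker, traceLinearMap_apply, trace_kronecker,
        hΦ X, hΨ Y]
  exact fun X => LinearMap.congr_fun h X

theorem tensorMap_prepareMap (A : Matrix a a ℂ) (B : Matrix a' a' ℂ) (A' : Matrix b b ℂ)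
    (B' : Matrix b' b' ℂ) :
    tensorMap (prepareMap A B) (prepareMap A' B') = prepareMap (A ⊗ₖ A') (B ⊗ₖ B') :=
  linearMap_ext_kronecker fun X Y => by
    simp only [tensorMap_kronecker, prepareMap_apply, ← mul_kronecker_mul, trace_kronecker,
      smul_kronecker, kronecker_smul, smul_smul, mul_comm]

end TensorProducts

section PartialTrace

variable {ι d d' : Type*} [Fintype ι] [Fintype d] [DecidableEq d]

/-- The partial trace `Tr_ι` on a system `d` that splits as `ι ⊗ d'` along `e`; other orders of
the tensor factors are covered by the choice of `e`. -/
def partialTraceMap (e : ι × d' ≃ d) : Matrix d d ℂ →ₗ[ℂ] Matrix d' d' ℂ :=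
  ∑ s, conjMap ((1 : Matrix d d ℂ).submatrix (fun i => e (s, i)) id)

theorem isChannel_partialTraceMap [Fintype d'] [DecidableEq d'] (e : ι × d' ≃ d) :
    IsChannel (partialTraceMap e) := by
  refine (isInstrument_conjMap ?_).isChannel_sum
  ext p q
  have h := e.sum_comp fun r => star ((1 : Matrix d d ℂ) r p) * (1 : Matrix d d ℂ) r q
  rw [Fintype.sum_prod_type] at h
  simp only [Matrix.sum_apply, Matrix.mul_apply, conjTranspose_apply, submatrix_apply]
  exact h.trans (by simp [Matrix.one_apply, eq_comm])

theorem tensorMap_partialTraceMap_apply {κ e e' : Type*} [Fintype κ] [Fintype e] [DecidableEq e]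
    [Fintype e'] [DecidableEq e'] [Fintype d'] [DecidableEq d'] (f : ι × d' ≃ d) (g : κ × e' ≃ e)
    (X : Matrix (d × e) (d × e) ℂ) (p q : d' × e') :
    tensorMap (partialTraceMap f) (partialTraceMap g) X p q =
      ∑ s, ∑ t, X (f (s, p.1), g (t, p.2)) (f (s, q.1), g (t, q.2)) := by
  simp only [partialTraceMap, tensorMap_sum_sum, tensorMap_conjMap,
    one_submatrix_kronecker_one_submatrix, LinearMap.sum_apply, conjMap_submatrix_one,
    Matrix.sum_apply, submatrix_apply, Prod.map]

end PartialTrace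

section Regroup

variable {a b a' b' : Type*} [Fintype a] [Fintype b] [Fintype a'] [Fintype b']
  (ρ : Matrix (a × b) (a × b) ℂ) (σ : Matrix (a' × b') (a' × b') ℂ)

theorem conjMap_regroup_kronecker {c e c' e' : Type*} (K : Matrix c a ℂ) (K' : Matrix c' a' ℂ)
    (L : Matrix e b ℂ) (L' : Matrix e' b' ℂ) :
    conjMap ((K ⊗ₖ K') ⊗ₖ (L ⊗ₖ L')) (regroup (ρ ⊗ₖ σ)) =
      regroup (conjMap (K ⊗ₖ L) ρ ⊗ₖ conjMap (K' ⊗ₖ L') σ) := by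
  have key : (K ⊗ₖ K') ⊗ₖ (L ⊗ₖ L') = ((K ⊗ₖ L) ⊗ₖ (K' ⊗ₖ L')).submatrix
      (Equiv.prodProdProdComm c e c' e').symm (Equiv.prodProdProdComm a b a' b').symm := by
    ext ⟨⟨i, i'⟩, ⟨j, j'⟩⟩ ⟨⟨k, k'⟩, ⟨l, l'⟩⟩
    exact mul_mul_mul_comm ..
  simp only [conjMap_apply, regroup, reindex_apply, key, conjTranspose_submatrix,
    submatrix_mul_equiv, mul_kronecker_mul, conjTranspose_kronecker]

variable [DecidableEq a] [DecidableEq b] [DecidableEq a'] [DecidableEq b']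

theorem tensorMap_partialTraceMap_regroup_left :
    tensorMap (partialTraceMap (Equiv.refl (a × a'))) (partialTraceMap (Equiv.refl (b × b')))
      (regroup (ρ ⊗ₖ σ)) = ρ.trace • σ := by
  ext p q
  rw [tensorMap_partialTraceMap_apply, Matrix.smul_apply, Matrix.trace, Fintype.sum_prod_type,
    smul_eq_mul, Finset.sum_mul]
  simp only [Finset.sum_mul]
  rfl

theorem tensorMap_partialTraceMap_regroup_right :
    tensorMap (partialTraceMap (Equiv.prodComm a' a)) (partialTraceMap (Equiv.prodComm b' b))
      (regroup (ρ ⊗ₖ σ)) = σ.trace • ρ := by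
  ext p q
  rw [tensorMap_partialTraceMap_apply, Matrix.smul_apply, Matrix.trace, Fintype.sum_prod_type,
    smul_eq_mul, mul_comm, Finset.mul_sum]
  simp only [Finset.mul_sum]
  rfl

end Regroup

section LOCC

variable {a b c e a' b' : Type} [Fintype a] [DecidableEq a] [Fintype b] [DecidableEq b]
  [Fintype c] [DecidableEq c] [Fintype e] [DecidableEq e] [Fintype a'] [DecidableEq a']
  [Fintype b'] [DecidableEq b']

theorem IsLOCC.sum_sum_comp_tensorMap {ι κ : Type} [Fintype ι] [Fintype κ]
    {E : ι → (Matrix a a ℂ →ₗ[ℂ] Matrix c c ℂ)} (hE : IsInstrument E)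
    {F : κ → (Matrix b b ℂ →ₗ[ℂ] Matrix e e ℂ)} (hF : IsInstrument F)
    {Λ : ι → κ → (Matrix (c × e) (c × e) ℂ →ₗ[ℂ] Matrix (a' × b') (a' × b') ℂ)}
    (hΛ : ∀ x y, IsLOCC (Λ x y)) :
    IsLOCC (∑ x, ∑ y, Λ x y ∘ₗ tensorMap (E x) (F y)) := by
  convert IsLOCC.alice E hE _ fun x => IsLOCC.bob F hF (Λ x) (hΛ x) using 2 with x
  ext1 X
  simp only [LinearMap.comp_apply, LinearMap.sum_apply]
  simp only [← LinearMap.comp_apply (tensorMap LinearMap.id _), tensorMap_comp_tensorMap,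
    LinearMap.id_comp, LinearMap.comp_id]

theorem IsLOCC.comp_tensorMap {Λ : Matrix (c × e) (c × e) ℂ →ₗ[ℂ] Matrix (a' × b') (a' × b') ℂ}
    (hΛ : IsLOCC Λ) {Φ : Matrix a a ℂ →ₗ[ℂ] Matrix c c ℂ} (hΦ : IsChannel Φ)
    {Ψ : Matrix b b ℂ →ₗ[ℂ] Matrix e e ℂ} (hΨ : IsChannel Ψ) :
    IsLOCC (Λ ∘ₗ tensorMap Φ Ψ) := by
  simpa only [Fintype.sum_unique] using
    IsLOCC.sum_sum_comp_tensorMap hΦ.isInstrument hΨ.isInstrument fun _ _ => hΛ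

end LOCC

section FilterStep

variable {q r d q' r' d' c c' : Type*} [Fintype q] [DecidableEq q] [Fintype r] [DecidableEq r]
  [Fintype d] [DecidableEq d] [Fintype q'] [DecidableEq q'] [Fintype r'] [DecidableEq r']
  [Fintype d'] [DecidableEq d'] [Fintype c] [Fintype c']

omit [Fintype q] [Fintype d] in
theorem sum_conjTranspose_mul_self_kronecker_one [Finite q] {ι : Type*} [Fintype ι]
    {k : ι → Matrix c q ℂ} (hk : ∑ x, (k x)ᴴ * k x = 1) (f : q × r ≃ d) :
    ∑ x, ((k x ⊗ₖ (1 : Matrix r r ℂ)).submatrix id f.symm)ᴴ *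
      (k x ⊗ₖ (1 : Matrix r r ℂ)).submatrix id f.symm = 1 := by
  have summand (x : ι) : ((k x ⊗ₖ (1 : Matrix r r ℂ)).submatrix id f.symm)ᴴ *
      (k x ⊗ₖ (1 : Matrix r r ℂ)).submatrix id f.symm =
        reindexLinearEquiv ℂ ℂ f f (((k x)ᴴ * k x) ⊗ₖ (1 : Matrix r r ℂ)) := by
    rw [conjTranspose_submatrix, ← submatrix_mul _ _ _ _ _ Function.bijective_id,
      conjTranspose_kronecker, ← mul_kronecker_mul, conjTranspose_one, Matrix.one_mul]
    rfl
  simp only [summand, ← map_sum, ← sum_kronecker, hk, one_kronecker_one, reindexLinearEquiv_one]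

theorem sum_trace_conjMap_kronecker {ι κ : Type*} [Fintype ι] [Fintype κ]
    {k : ι → Matrix c q ℂ} (hk : ∑ x, (k x)ᴴ * k x = 1) {l : κ → Matrix c' q' ℂ}
    (hl : ∑ y, (l y)ᴴ * l y = 1) (ρ : Matrix (q × q') (q × q') ℂ) :
    ∑ x, ∑ y, (conjMap (k x ⊗ₖ l y) ρ).trace = ρ.trace := by
  classical
  rw [← (isInstrument_conjMap hk).2.tensorMap (isInstrument_conjMap hl).2 ρ, tensorMap_sum_sum]
  simp only [LinearMap.sum_apply, trace_sum, tensorMap_conjMap]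

variable [DecidableEq c] [DecidableEq c']

omit [DecidableEq q] [DecidableEq q'] in
theorem tensorMap_conjMap_kronecker_one_regroup (f : q × r ≃ d) (g : q' × r' ≃ d')
    (k : Matrix c q ℂ) (l : Matrix c' q' ℂ) (ρ : Matrix (q × q') (q × q') ℂ)
    (τ : Matrix (r × r') (r × r') ℂ) :
    tensorMap (conjMap ((k ⊗ₖ (1 : Matrix r r ℂ)).submatrix id f.symm))
        (conjMap ((l ⊗ₖ (1 : Matrix r' r' ℂ)).submatrix id g.symm))
        (reindex (f.prodCongr g) (f.prodCongr g) (regroup (ρ ⊗ₖ τ))) =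
      regroup (conjMap (k ⊗ₖ l) ρ ⊗ₖ τ) := by
  have h := conjMap_regroup_kronecker ρ τ k (1 : Matrix r r ℂ) l (1 : Matrix r' r' ℂ)
  rw [one_kronecker_one, conjMap_one, LinearMap.id_apply] at h
  have key : (k ⊗ₖ (1 : Matrix r r ℂ)).submatrix id f.symm ⊗ₖ
      (l ⊗ₖ (1 : Matrix r' r' ℂ)).submatrix id g.symm =
      ((k ⊗ₖ (1 : Matrix r r ℂ)) ⊗ₖ (l ⊗ₖ (1 : Matrix r' r' ℂ))).submatrix id
        (f.prodCongr g).symm := rfl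
  rw [← h, tensorMap_conjMap, key, conjMap_submatrix_reindex]

end FilterStep

section FilteringProtocol

variable {q r d q' r' d' c c' : Type} [Fintype q] [DecidableEq q] [Fintype r] [DecidableEq r]
  [Fintype d] [DecidableEq d] [Fintype q'] [DecidableEq q'] [Fintype r'] [DecidableEq r']
  [Fintype d'] [DecidableEq d'] [Fintype c] [DecidableEq c] [Fintype c'] [DecidableEq c']

/-- If both filters succeed on the first pair of systems the filtered state is kept, otherwise the
protocol `Λ` is run on the second pair. -/
theorem IsLOCC.exists_filter_step [Nonempty c] [Nonempty c'] (f : q × r ≃ d) (g : q' × r' ≃ d')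
    {K : Matrix c q ℂ} (hK : (1 - Kᴴ * K).PosSemidef)
    {L : Matrix c' q' ℂ} (hL : (1 - Lᴴ * L).PosSemidef)
    {Λ : Matrix (r × r') (r × r') ℂ →ₗ[ℂ] Matrix (c × c') (c × c') ℂ} (hΛ : IsLOCC Λ) :
    ∃ Ξ : Matrix (d × d') (d × d') ℂ →ₗ[ℂ] Matrix (c × c') (c × c') ℂ, IsLOCC Ξ ∧ ∀ ρ τ,
      Ξ (reindex (f.prodCongr g) (f.prodCongr g) (regroup (ρ ⊗ₖ τ))) =
        τ.trace • conjMap (K ⊗ₖ L) ρ + (ρ.trace - (conjMap (K ⊗ₖ L) ρ).trace) • Λ τ := by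
  obtain ⟨k, hk, rfl⟩ := exists_kraus_of_contraction hK
  obtain ⟨l, hl, rfl⟩ := exists_kraus_of_contraction hL
  let keep := tensorMap (partialTraceMap (Equiv.prodComm r c))
    (partialTraceMap (Equiv.prodComm r' c'))
  let retry := Λ ∘ₗ tensorMap (partialTraceMap (Equiv.refl (c × r)))
    (partialTraceMap (Equiv.refl (c' × r')))
  have hkeep : IsLOCC keep :=
    .localOps _ _ (isChannel_partialTraceMap _) (isChannel_partialTraceMap _)
  have hretry : IsLOCC retry :=
    hΛ.comp_tensorMap (isChannel_partialTraceMap _) (isChannel_partialTraceMap _)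
  refine ⟨_, .sum_sum_comp_tensorMap
    (isInstrument_conjMap (sum_conjTranspose_mul_self_kronecker_one hk f))
    (isInstrument_conjMap (sum_conjTranspose_mul_self_kronecker_one hl g))
    (Λ := fun x y => if x = none ∧ y = none then keep else retry)
    (fun x y => by split_ifs <;> assumption), fun ρ τ => ?_⟩
  have outcome (x : Option q) (y : Option q') :
      (if x = none ∧ y = none then keep else retry) (regroup (conjMap (k x ⊗ₖ l y) ρ ⊗ₖ τ)) =
        (conjMap (k x ⊗ₖ l y) ρ).trace • Λ τ + if x = none then if y = none then
          τ.trace • conjMap (k none ⊗ₖ l none) ρ -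
            (conjMap (k none ⊗ₖ l none) ρ).trace • Λ τ else 0 else 0 := by
    rw [← ite_and]
    split_ifs with h
    · obtain ⟨rfl, rfl⟩ := h
      rw [add_sub_cancel, tensorMap_partialTraceMap_regroup_right]
    · rw [add_zero, LinearMap.comp_apply, tensorMap_partialTraceMap_regroup_left, map_smul]
  simp only [LinearMap.sum_apply, LinearMap.comp_apply, tensorMap_conjMap_kronecker_one_regroup,
    outcome, Finset.sum_add_distrib, ← Finset.sum_smul, sum_trace_conjMap_kronecker hk hl]
  simp only [Fintype.sum_option, if_true, reduceCtorEq, if_false, Finset.sum_const_zero, add_zero]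
  module

end FilteringProtocol

section TensorPower

variable {a b c e : Type*}

/-- The `m`-fold tensor power `M^{⊗m}` of a matrix. -/
def piKron (M : Matrix c a ℂ) (m : ℕ) : Matrix (Fin m → c) (Fin m → a) ℂ :=
  Matrix.of fun p q => ∏ k, M (p k) (q k)

theorem piKron_mul [Fintype c] (M : Matrix a c ℂ) (M' : Matrix c b ℂ) (m : ℕ) :
    piKron M m * piKron M' m = piKron (M * M') m := by
  classical
  ext p q
  simp only [piKron, Matrix.mul_apply, of_apply, ← Finset.prod_mul_distrib,
    Finset.prod_univ_sum, Fintype.piFinset_univ]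

theorem conjTranspose_piKron (M : Matrix c a ℂ) (m : ℕ) : (piKron M m)ᴴ = piKron Mᴴ m := by
  ext p q
  simp only [piKron, conjTranspose_apply, of_apply, star_prod]

theorem piKron_kronecker_piKron (M : Matrix a c ℂ) (M' : Matrix b e ℂ) (m : ℕ) :
    piKron M m ⊗ₖ piKron M' m = (piKron (M ⊗ₖ M') m).submatrix
      (Equiv.arrowProdEquivProdArrow (Fin m) (fun _ => a) (fun _ => b)).symm
      (Equiv.arrowProdEquivProdArrow (Fin m) (fun _ => c) (fun _ => e)).symm := by
  ext ⟨p, p'⟩ ⟨q, q'⟩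
  exact (Finset.prod_mul_distrib (f := fun k => M (p k) (q k))
    (g := fun k => M' (p' k) (q' k)) (s := Finset.univ)).symm

theorem tensorPower_eq_submatrix_piKron (ω : Matrix (a × b) (a × b) ℂ) (m : ℕ) :
    tensorPower ω m = (piKron ω m).submatrix
      (Equiv.arrowProdEquivProdArrow (Fin m) (fun _ => a) (fun _ => b)).symm
      (Equiv.arrowProdEquivProdArrow (Fin m) (fun _ => a) (fun _ => b)).symm := rfl

/-- The grouping of `m * n` systems into `m` blocks of `n` systems each. -/
def blockEquiv {a : Type*} (m n : ℕ) : (Fin m → Fin n → a) ≃ (Fin (m * n) → a) :=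
  (Equiv.curry _ _ _).symm.trans (finProdFinEquiv.arrowCongr (Equiv.refl a))

theorem tensorPower_add (ω : Matrix (a × b) (a × b) ℂ) (m n : ℕ) :
    tensorPower ω (m + n) =
      reindex ((Fin.appendEquiv m n).prodCongr (Fin.appendEquiv m n))
        ((Fin.appendEquiv m n).prodCongr (Fin.appendEquiv m n))
        (regroup (tensorPower ω m ⊗ₖ tensorPower ω n)) := by
  ext p q
  exact Fin.prod_univ_add _

theorem tensorPower_mul (ω : Matrix (a × b) (a × b) ℂ) (m n : ℕ) :
    tensorPower ω (m * n) =
      reindex ((blockEquiv m n).prodCongr (blockEquiv m n))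
        ((blockEquiv m n).prodCongr (blockEquiv m n)) (tensorPower (tensorPower ω n) m) := by
  ext p q
  simp only [tensorPower, of_apply, reindex_apply, submatrix_apply]
  rw [← Equiv.prod_comp finProdFinEquiv, Fintype.prod_prod_type]
  rfl

theorem posSemidef_tensorPower [Finite a] [Finite b] {ω : Matrix (a × b) (a × b) ℂ}
    (hω : ω.PosSemidef) (m : ℕ) :
    (tensorPower ω m).PosSemidef := by
  have := Fintype.ofFinite a
  have := Fintype.ofFinite b
  obtain ⟨S, rfl⟩ := exists_eq_conjTranspose_mul_self hω
  rw [tensorPower_eq_submatrix_piKron, ← piKron_mul, ← conjTranspose_piKron]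
  exact (posSemidef_conjTranspose_mul_self _).submatrix _

variable [Fintype a] [Fintype b]

theorem conjMap_piKron_tensorPower (M : Matrix c a ℂ) (M' : Matrix e b ℂ)
    (ω : Matrix (a × b) (a × b) ℂ) (m : ℕ) :
    conjMap (piKron M m ⊗ₖ piKron M' m) (tensorPower ω m) =
      tensorPower (conjMap (M ⊗ₖ M') ω) m := by
  simp only [conjMap_apply, piKron_kronecker_piKron, tensorPower_eq_submatrix_piKron,
    conjTranspose_submatrix, submatrix_mul_equiv, conjTranspose_piKron, piKron_mul]

theorem trace_tensorPower (ω : Matrix (a × b) (a × b) ℂ) (n : ℕ) :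
    (tensorPower ω n).trace = ω.trace ^ n := by
  simp only [Matrix.trace, diag_apply, tensorPower, of_apply]
  rw [← Equiv.sum_comp (Equiv.arrowProdEquivProdArrow (Fin n) (fun _ => a) (fun _ => b)),
    ← Fin.prod_const, Finset.prod_univ_sum]
  simp only [Equiv.arrowProdEquivProdArrow, Equiv.coe_fn_mk, Fintype.piFinset_univ]

end TensorPower

section Reachability

variable {a b c c' : Type} [Fintype a] [DecidableEq a] [Fintype b] [DecidableEq b]
  [Fintype c] [DecidableEq c] [Fintype c'] [DecidableEq c']

/-- The operator `D` is the output of some LOCC protocol on `n` copies of `ω`. -/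
def LOCCReaches (ω : Matrix (a × b) (a × b) ℂ) (n : ℕ) (D : Matrix (c × c') (c × c') ℂ) : Prop :=
  ∃ Λ : Matrix ((Fin n → a) × (Fin n → b)) ((Fin n → a) × (Fin n → b)) ℂ →ₗ[ℂ]
    Matrix (c × c') (c × c') ℂ, IsLOCC Λ ∧ Λ (tensorPower ω n) = D

variable {ω : Matrix (a × b) (a × b) ℂ} (hω : ω.trace = 1)
include hω

theorem LOCCReaches.kronecker (n : ℕ) {B : Matrix c c ℂ} (hB : IsState B) {B' : Matrix c' c' ℂ}
    (hB' : IsState B') : LOCCReaches ω n (B ⊗ₖ B') :=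
  ⟨_, .localOps _ _ (isChannel_prepareMap_one hB) (isChannel_prepareMap_one hB'), by
    rw [tensorMap_prepareMap, prepareMap_apply, one_kronecker_one, Matrix.one_mul,
      trace_tensorPower, hω, one_pow, one_smul]⟩

theorem LOCCReaches.filter_step [Nonempty c] [Nonempty c'] {N n : ℕ}
    {K : Matrix c (Fin N → a) ℂ} (hK : (1 - Kᴴ * K).PosSemidef)
    {L : Matrix c' (Fin N → b) ℂ} (hL : (1 - Lᴴ * L).PosSemidef)
    {D : Matrix (c × c') (c × c') ℂ} (hD : LOCCReaches ω n D) :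
    LOCCReaches ω (N + n) (conjMap (K ⊗ₖ L) (tensorPower ω N) +
      (1 - (conjMap (K ⊗ₖ L) (tensorPower ω N)).trace) • D) := by
  obtain ⟨Λ, hΛ, rfl⟩ := hD
  obtain ⟨Ξ, hΞ, hΞeq⟩ :=
    hΛ.exists_filter_step (Fin.appendEquiv (α := a) N n) (Fin.appendEquiv (α := b) N n) hK hL
  refine ⟨Ξ, hΞ, ?_⟩
  rw [tensorPower_add, hΞeq, trace_tensorPower, trace_tensorPower, hω, one_pow, one_pow, one_smul]

end Reachability

section TraceNorm

variable {d : Type*} [Fintype d] [DecidableEq d]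

theorem traceNorm_nonneg (X : Matrix d d ℂ) : 0 ≤ traceNorm X :=
  Finset.sum_nonneg fun _ _ => Real.sqrt_nonneg _

theorem traceNorm_sq_le (X : Matrix d d ℂ) :
    traceNorm X ^ 2 ≤ Fintype.card d * (Xᴴ * X).trace.re := by
  have nonneg (i) : 0 ≤ (isHermitian_conjTranspose_mul_self X).eigenvalues i :=
    (posSemidef_conjTranspose_mul_self X).eigenvalues_nonneg i
  have trace_eq :
      (Xᴴ * X).trace.re = ∑ i, (isHermitian_conjTranspose_mul_self X).eigenvalues i := by
    rw [(isHermitian_conjTranspose_mul_self X).trace_eq_sum_eigenvalues, ← RCLike.ofReal_sum]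
    exact Complex.ofReal_re _
  rw [trace_eq, traceNorm]
  refine sq_sum_le_card_mul_sum_sq.trans_eq ?_
  simp only [Real.sq_sqrt (nonneg _), Finset.card_univ]

omit [DecidableEq d] in
theorem IsState.re_trace_mul_self_le_one {ρ : Matrix d d ℂ} (hρ : IsState ρ) :
    (ρ * ρ).trace.re ≤ 1 := by
  classical
  have h := trace_mul_nonneg (posSemidef_trace_smul_one_sub hρ.1) hρ.1
  rw [hρ.2, one_smul, Matrix.sub_mul, Matrix.one_mul, trace_sub, hρ.2, sub_nonneg] at h
  exact (Complex.le_def.mp h).1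

theorem IsState.traceNorm_sub_sq_le {ρ σ : Matrix d d ℂ} (hρ : IsState ρ) (hσ : IsState σ) :
    traceNorm (ρ - σ) ^ 2 ≤ 2 * Fintype.card d * (1 - (σ * ρ).trace.re) := by
  have trace_sq : ((ρ - σ)ᴴ * (ρ - σ)).trace.re =
      (ρ * ρ).trace.re + (σ * σ).trace.re - 2 * (σ * ρ).trace.re := by
    rw [(hρ.1.isHermitian.sub hσ.1.isHermitian).eq, Matrix.sub_mul, Matrix.mul_sub, Matrix.mul_sub,
      trace_sub, trace_sub, trace_sub, trace_mul_comm ρ σ]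
    simp only [Complex.sub_re]
    ring
  calc traceNorm (ρ - σ) ^ 2
      ≤ Fintype.card d * ((ρ * ρ).trace.re + (σ * σ).trace.re - 2 * (σ * ρ).trace.re) :=
        trace_sq ▸ traceNorm_sq_le _
    _ ≤ Fintype.card d * (1 + 1 - 2 * (σ * ρ).trace.re) := by
        gcongr
        exacts [hρ.re_trace_mul_self_le_one, hσ.re_trace_mul_self_le_one]
    _ = 2 * Fintype.card d * (1 - (σ * ρ).trace.re) := by ring

end TraceNorm

section Contraction

variable {a b c e : Type*} [DecidableEq a] [DecidableEq b] [Fintype c] [Fintype e]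

theorem posSemidef_one_sub_conjTranspose_mul_self_kronecker [Finite a] [Finite b]
    {K : Matrix c a ℂ}
    (hK : (1 - Kᴴ * K).PosSemidef) {L : Matrix e b ℂ} (hL : (1 - Lᴴ * L).PosSemidef) :
    (1 - (K ⊗ₖ L)ᴴ * (K ⊗ₖ L)).PosSemidef := by
  have := Fintype.ofFinite a
  have := Fintype.ofFinite b
  have key : 1 - (K ⊗ₖ L)ᴴ * (K ⊗ₖ L) =
      (1 - Kᴴ * K) ⊗ₖ (1 : Matrix b b ℂ) + (Kᴴ * K) ⊗ₖ (1 - Lᴴ * L) := by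
    rw [conjTranspose_kronecker, ← mul_kronecker_mul, ← one_kronecker_one]
    ext ⟨i, j⟩ ⟨i', j'⟩
    simp only [Matrix.add_apply, Matrix.sub_apply, kronecker_apply]
    ring
  rw [key]
  exact (hK.kronecker PosSemidef.one).add ((posSemidef_conjTranspose_mul_self K).kronecker hL)

theorem trace_conjMap_le [Fintype a] {K : Matrix c a ℂ} (hK : (1 - Kᴴ * K).PosSemidef)
    {X : Matrix a a ℂ} (hX : X.PosSemidef) : (conjMap K X).trace ≤ X.trace := by
  have h := trace_mul_nonneg hK hX
  rwa [Matrix.sub_mul, Matrix.one_mul, trace_sub, sub_nonneg, ← trace_conjMap] at h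

theorem exists_smul_contraction [Finite a] (K : Matrix c a ℂ) : ∃ t : ℝ, 0 < t ∧
    (1 - ((t : ℂ) • K)ᴴ * ((t : ℂ) • K)).PosSemidef := by
  have := Fintype.ofFinite a
  have hG := posSemidef_conjTranspose_mul_self K
  obtain ⟨g, hg, hgG⟩ : ∃ g : ℝ, 0 ≤ g ∧ (g : ℂ) = (Kᴴ * K).trace :=
    RCLike.nonneg_iff_exists_ofReal.mp hG.trace_nonneg
  obtain ⟨t, ht, htg⟩ : ∃ t : ℝ, 0 < t ∧ t ^ 2 * g ≤ 1 := by
    refine ⟨(1 + g)⁻¹, by positivity, ?_⟩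
    rw [inv_pow, inv_mul_le_one₀ (by positivity)]
    nlinarith
  refine ⟨t, ht, ?_⟩
  have key : 1 - ((t : ℂ) • K)ᴴ * ((t : ℂ) • K) =
      ((1 - t ^ 2 * g : ℝ) : ℂ) • (1 : Matrix a a ℂ) +
        ((t ^ 2 : ℝ) : ℂ) • ((Kᴴ * K).trace • 1 - Kᴴ * K) := by
    rw [conjTranspose_smul, Matrix.smul_mul, Matrix.mul_smul, RCLike.star_def, Complex.conj_ofReal,
      ← hgG]
    push_cast
    module
  rw [key]
  exact (PosSemidef.one.smul (Complex.zero_le_real.mpr (sub_nonneg.mpr htg))).add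
    ((posSemidef_trace_smul_one_sub hG).smul (Complex.zero_le_real.mpr (sq_nonneg t)))

omit [Fintype c] [DecidableEq a] [DecidableEq b] [Fintype e] in
theorem conjMap_smul_kronecker_smul [Fintype a] [Fintype b] (s t : ℝ)
    (K : Matrix c a ℂ) (L : Matrix e b ℂ) (X : Matrix (a × b) (a × b) ℂ) :
    conjMap (((s : ℂ) • K) ⊗ₖ ((t : ℂ) • L)) X = (s * t) ^ 2 • conjMap (K ⊗ₖ L) X := by
  simp only [conjMap_apply, smul_kronecker, kronecker_smul, conjTranspose_smul, RCLike.star_def,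
    Matrix.smul_mul, Matrix.mul_smul, smul_smul, ← Complex.coe_smul, map_mul, Complex.conj_ofReal]
  push_cast
  ring_nf

end Contraction

section Criterion

theorem exists_seq_tendsto_zero {α : ℕ → Type*} {P : ∀ n, α n → Prop} {f : ∀ n, α n → ℝ}
    (hP : ∀ n, ∃ x, P n x) (hf : ∀ n x, 0 ≤ f n x)
    (h : ∀ ε > 0, ∀ᶠ n in atTop, ∃ x, P n x ∧ f n x ≤ ε) :
    ∃ x : ∀ n, α n, (∀ n, P n (x n)) ∧ Tendsto (fun n => f n (x n)) atTop (𝓝 0) := by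
  have near_optimal (n : ℕ) :
      ∃ x, P n x ∧ ∀ y, P n y → f n x ≤ f n y + 1 / ((n : ℝ) + 1) := by
    have hbdd : BddBelow (f n '' {x | P n x}) := ⟨0, by rintro _ ⟨x, -, rfl⟩; exact hf n x⟩
    obtain ⟨_, ⟨x, hx, rfl⟩, hlt⟩ :=
      Real.lt_sInf_add_pos (Set.Nonempty.image (f n) (hP n)) (Nat.one_div_pos_of_nat (n := n))
    exact ⟨x, hx, fun y hy => hlt.le.trans (by gcongr; exact csInf_le hbdd ⟨y, hy, rfl⟩)⟩
  choose x hx hmin using near_optimal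
  refine ⟨x, hx, tendsto_order.mpr ⟨fun r hr => .of_forall fun n => hr.trans_le (hf n _),
    fun ε hε => ?_⟩⟩
  filter_upwards [h (ε / 2) (half_pos hε),
    tendsto_one_div_add_atTop_nhds_zero_nat.eventually_lt_const (half_pos hε)]
    with n ⟨y, hy, hyε⟩ hn
  linarith [hmin n y hy]

theorem isState_single {d : Type*} [Fintype d] [DecidableEq d] (i : d) :
    IsState (Matrix.single i i (1 : ℂ)) :=
  ⟨posSemidef_single i, trace_single_eq_same i 1⟩

variable {a b c c' : Type} [Fintype a] [DecidableEq a] [Fintype b] [DecidableEq b]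
  [Fintype c] [DecidableEq c] [Fintype c'] [DecidableEq c']

theorem exists_loccReaches_repeat_filter [Nonempty c] [Nonempty c'] {ω : Matrix (a × b) (a × b) ℂ}
    (hω : IsState ω) {σ : Matrix (c × c') (c × c') ℂ} (hσ : σ.PosSemidef) {N : ℕ}
    {K : Matrix c (Fin N → a) ℂ} (hK : (1 - Kᴴ * K).PosSemidef)
    {L : Matrix c' (Fin N → b) ℂ} (hL : (1 - Lᴴ * L).PosSemidef) {X : Matrix (c × c') (c × c') ℂ}
    (hX : conjMap (K ⊗ₖ L) (tensorPower ω N) = X) {ε : ℝ} (hε : 0 ≤ ε)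
    (hfid : (1 - ε) * X.trace.re ≤ (σ * X).trace.re) (r M : ℕ) :
    ∃ D, LOCCReaches ω (N * M + r) D ∧ IsState D ∧
      1 - ε - (1 - X.trace.re) ^ M ≤ (σ * D).trace.re := by
  induction M with
  | zero =>
    have hB := isState_single (Classical.arbitrary c)
    have hB' := isState_single (Classical.arbitrary c')
    refine ⟨_, .kronecker hω.2 _ hB hB',
      ⟨hB.1.kronecker hB'.1, by rw [trace_kronecker, hB.2, hB'.2, one_mul]⟩, ?_⟩
    have := (Complex.le_def.mp (trace_mul_nonneg hσ (hB.1.kronecker hB'.1))).1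
    rw [Complex.zero_re] at this
    rw [pow_zero]
    linarith
  | succ M ih =>
    obtain ⟨D, hD, hDstate, hDfid⟩ := ih
    have hXpos : X.PosSemidef := hX ▸ (posSemidef_tensorPower hω.1 N).mul_mul_conjTranspose_same _
    have hXreal : X.trace = X.trace.re := Complex.eq_re_of_ofReal_le hXpos.trace_nonneg
    have hXle : 0 ≤ 1 - X.trace := by
      have := trace_conjMap_le (posSemidef_one_sub_conjTranspose_mul_self_kronecker hK hL)
        (posSemidef_tensorPower hω.1 N)
      rwa [hX, trace_tensorPower, hω.2, one_pow, ← sub_nonneg] at this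
    have hstep := hD.filter_step hω.2 hK hL
    rw [hX, show N + (N * M + r) = N * (M + 1) + r by ring] at hstep
    refine ⟨_, hstep, ⟨hXpos.add (hDstate.1.smul hXle), ?_⟩, ?_⟩
    · rw [trace_add, trace_smul, hDstate.2, smul_eq_mul, mul_one, add_sub_cancel]
    · rw [hXreal, ← Complex.ofReal_one, ← Complex.ofReal_sub, Complex.zero_le_real] at hXle
      calc 1 - ε - (1 - X.trace.re) ^ (M + 1)
          = (1 - ε) * X.trace.re + (1 - X.trace.re) * (1 - ε - (1 - X.trace.re) ^ M) := by ring
        _ ≤ (σ * X).trace.re + (1 - X.trace.re) * (σ * D).trace.re := by gcongr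
        _ = (σ * (X + (1 - X.trace) • D)).trace.re := by
          rw [Matrix.mul_add, Matrix.mul_smul, trace_add, trace_smul, hXreal]
          simp

theorem isLOCCDistillable_of_filter {ω : Matrix (a × b) (a × b) ℂ} (hω : IsState ω)
    (h : ∀ ε > 0, ∃ (N : ℕ) (K : Matrix (Fin 2) (Fin N → a) ℂ) (L : Matrix (Fin 2) (Fin N → b) ℂ)
      (X : Matrix (Fin 2 × Fin 2) (Fin 2 × Fin 2) ℂ), conjMap (K ⊗ₖ L) (tensorPower ω N) = X ∧
      0 < X.trace.re ∧ (1 - ε) * X.trace.re ≤ (phiPlus 2 * X).trace.re) :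
    IsLOCCDistillable ω := by
  refine exists_seq_tendsto_zero (P := fun _ Λ => IsLOCC Λ)
    (f := fun n Λ => traceNorm (Λ (tensorPower ω n) - phiPlus 2))
    (fun n => (LOCCReaches.kronecker hω.2 n (isState_single 0) (isState_single 0)).imp
      fun _ => And.left) (fun n Λ => traceNorm_nonneg _) fun ε hε => ?_
  obtain ⟨N, K, L, X, hX, hpos, hfid⟩ := h (ε ^ 2 / 16) (by positivity)
  obtain ⟨s, hs, hsK⟩ := exists_smul_contraction K
  obtain ⟨t, ht, htL⟩ := exists_smul_contraction L
  have success_pos : 0 < ((s * t) ^ 2 • X).trace.re := by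
    rw [trace_smul, Complex.smul_re, smul_eq_mul]
    positivity
  have scaled_fid : (1 - ε ^ 2 / 16) * ((s * t) ^ 2 • X).trace.re ≤
      (phiPlus 2 * ((s * t) ^ 2 • X)).trace.re := by
    rw [Matrix.mul_smul, trace_smul, trace_smul, Complex.smul_re, Complex.smul_re, smul_eq_mul,
      smul_eq_mul, mul_left_comm]
    gcongr
  obtain ⟨M, hM⟩ := exists_pow_lt_of_lt_one (show 0 < ε ^ 2 / 16 by positivity)
    (sub_lt_self 1 success_pos)
  filter_upwards [eventually_ge_atTop (N * M)] with n hn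
  obtain ⟨r, rfl⟩ := Nat.exists_eq_add_of_le hn
  obtain ⟨_, ⟨Λ, hΛ, rfl⟩, hD, hDfid⟩ := exists_loccReaches_repeat_filter hω (posSemidef_phiPlus 2)
    hsK htL ((conjMap_smul_kronecker_smul s t K L _).trans (by rw [hX])) (by positivity)
    scaled_fid r M
  refine ⟨Λ, hΛ, le_of_sq_le_sq ?_ hε.le⟩
  have hnorm := hD.traceNorm_sub_sq_le ⟨posSemidef_phiPlus 2, trace_phiPlus two_ne_zero⟩
  rw [Fintype.card_prod, Fintype.card_fin] at hnorm
  norm_num at hnorm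
  linarith

end Criterion

section RepetitionCode

variable {a b : Type*} [DecidableEq a] [DecidableEq b]

/-- The filter `∑ₛ |s⟩⟨s⋯s|`, which decodes the `m`-fold repetition code. -/
def repetitionFilter (a : Type*) [DecidableEq a] (m : ℕ) : Matrix a (Fin m → a) ℂ :=
  (1 : Matrix (Fin m → a) (Fin m → a) ℂ).submatrix (fun s _ => s) id

variable [Fintype a] [Fintype b]

theorem conjMap_repetitionFilter_tensorPower (ω : Matrix (a × b) (a × b) ℂ) (m : ℕ) :
    conjMap (repetitionFilter a m ⊗ₖ repetitionFilter b m) (tensorPower ω m) = ω.map (· ^ m) := by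
  rw [repetitionFilter, repetitionFilter, one_submatrix_kronecker_one_submatrix,
    conjMap_submatrix_one]
  ext p q
  simp [tensorPower]

variable {c e : Type*} [Fintype c] [DecidableEq c] [Fintype e] [DecidableEq e]

/-- The decoder of a concatenated code: each block of `n` systems passes the repetition filter,
then the local operator `M`, and the `m` resulting systems pass the repetition filter again. -/
def concatenatedFilter (M : Matrix c a ℂ) (m n : ℕ) : Matrix c (Fin (m * n) → a) ℂ :=
  (repetitionFilter c m * piKron (M * repetitionFilter a n) m).submatrix id (blockEquiv m n).symm

theorem conjMap_concatenatedFilter_tensorPower (M : Matrix c a ℂ) (M' : Matrix e b ℂ)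
    (ω : Matrix (a × b) (a × b) ℂ) (m n : ℕ) :
    conjMap (concatenatedFilter M m n ⊗ₖ concatenatedFilter M' m n) (tensorPower ω (m * n)) =
      (conjMap (M ⊗ₖ M') (ω.map (· ^ n))).map (· ^ m) := by
  have key : concatenatedFilter M m n ⊗ₖ concatenatedFilter M' m n =
      ((repetitionFilter c m * piKron (M * repetitionFilter a n) m) ⊗ₖ
        (repetitionFilter e m * piKron (M' * repetitionFilter b n) m)).submatrix id
        ((blockEquiv m n).prodCongr (blockEquiv m n)).symm := rfl
  rw [key, tensorPower_mul, conjMap_submatrix_reindex, mul_kronecker_mul, conjMap_mul,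
    conjMap_piKron_tensorPower, conjMap_repetitionFilter_tensorPower, mul_kronecker_mul,
    conjMap_mul, conjMap_repetitionFilter_tensorPower]

end RepetitionCode

section HadamardCode

/-- The (unnormalised) change from the computational to the conjugate basis of a qubit. -/
def hadamard : Matrix (Fin 2) (Fin 2) ℂ := !![1, 1; 1, -1]

theorem conjMap_hadamard_isotropic_pow (x y : ℂ) {n : ℕ} (hn : n ≠ 0) (p q : Fin 2 × Fin 2) :
    conjMap (hadamard ⊗ₖ hadamard) ((isotropic x y).map (· ^ n)) p q =
      if p = q then 2 * ((x + y) ^ n + x ^ n + if p.1 = p.2 then y ^ n else -y ^ n)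
      else if p.1 + p.2 = q.1 + q.2 then
        2 * ((x + y) ^ n - x ^ n + if p.1 = p.2 then y ^ n else -y ^ n)
      else 0 := by
  obtain ⟨i, k⟩ := p
  obtain ⟨j, l⟩ := q
  simp only [conjMap_apply, hadamard, isotropic, Matrix.mul_apply, Fintype.sum_prod_type,
    Fin.sum_univ_two, kroneckerMap_apply, conjTranspose_apply, Matrix.map_apply,
    Matrix.add_apply, Matrix.smul_apply, Matrix.one_apply, phiPlus_apply, Prod.mk.injEq]
  fin_cases i <;> fin_cases k <;> fin_cases j <;> fin_cases l <;> simp [hn] <;> ring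

theorem trace_decoded_isotropic (x y : ℂ) {n : ℕ} (hn : n ≠ 0) (m : ℕ) :
    ((conjMap (hadamard ⊗ₖ hadamard) ((isotropic x y).map (· ^ n))).map (· ^ m)).trace =
      2 * (2 * ((x + y) ^ n + x ^ n + y ^ n)) ^ m +
        2 * (2 * ((x + y) ^ n + x ^ n - y ^ n)) ^ m := by
  simp [Matrix.trace, Fintype.sum_prod_type, conjMap_hadamard_isotropic_pow x y hn]
  ring

theorem trace_phiPlus_mul_decoded_isotropic (x y : ℂ) {n : ℕ} (hn : n ≠ 0) (m : ℕ) :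
    (phiPlus 2 *
        (conjMap (hadamard ⊗ₖ hadamard) ((isotropic x y).map (· ^ n))).map (· ^ m)).trace =
      (2 * ((x + y) ^ n + x ^ n + y ^ n)) ^ m + (2 * ((x + y) ^ n - x ^ n + y ^ n)) ^ m := by
  simp [Matrix.trace, Matrix.mul_apply, Fintype.sum_prod_type, phiPlus_apply, ite_and,
    conjMap_hadamard_isotropic_pow x y hn]
  ring

end HadamardCode

section ErrorRates

theorem one_sub_pow_le_inv {r : ℝ} (h0 : 0 ≤ r) (h1 : r ≤ 1) (m : ℕ) :
    (1 - r) ^ m ≤ (1 + m * r)⁻¹ := by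
  rw [← one_div, le_div_iff₀ (by positivity)]
  calc (1 - r) ^ m * (1 + m * r)
      ≤ (1 - r) ^ m * (1 + r) ^ m :=
        mul_le_mul_of_nonneg_left (one_add_mul_le_pow (by linarith) m)
          (pow_nonneg (sub_nonneg.mpr h1) m)
    _ = (1 - r ^ 2) ^ m := by rw [← mul_pow]; ring
    _ ≤ 1 := pow_le_one₀ (sub_nonneg.mpr (pow_le_one₀ h0 h1)) (sub_le_self 1 (sq_nonneg r))

theorem exists_one_sub_pow_le_le_one_sub_pow {ε r w : ℝ} (hε : 0 < ε) (hr : 0 < r) (hr1 : r ≤ 1)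
    (hw : 0 ≤ w) (hw1 : w ≤ 1) (hwr : w * (1 + ε) ≤ ε ^ 2 * r) :
    ∃ m : ℕ, (1 - r) ^ m ≤ ε ∧ 1 - ε ≤ (1 - w) ^ m := by
  refine ⟨⌈1 / (ε * r)⌉₊, (one_sub_pow_le_inv hr.le hr1 _).trans ?_, ?_⟩
  · have hm := (div_le_iff₀ (by positivity)).mp (Nat.le_ceil (1 / (ε * r)))
    rw [inv_le_iff_one_le_mul₀ (by positivity)]
    linarith
  · have hm := (Nat.ceil_lt_add_one (show 0 ≤ 1 / (ε * r) by positivity)).le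
    have hmw : ⌈1 / (ε * r)⌉₊ * w ≤ ε := by
      calc ⌈1 / (ε * r)⌉₊ * w
          ≤ (1 / (ε * r) + 1) * (ε ^ 2 * r / (1 + ε)) := by
            gcongr
            exact (le_div_iff₀ (by positivity)).mpr hwr
        _ = ε * (1 + ε * r) / (1 + ε) := by field_simp
        _ ≤ ε := by
            rw [div_le_iff₀ (by positivity)]
            gcongr
            exact mul_le_of_le_one_right hε.le hr1
    have bernoulli := one_add_mul_le_pow (show -2 ≤ -w by linarith) ⌈1 / (ε * r)⌉₊
    rw [← sub_eq_add_neg] at bernoulli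
    linarith

/-- The inner length `n` makes the bit error weight `x ^ n` negligible against the coherence
`y ^ n`; the outer length `m` is then just large enough to suppress the phase errors. -/
theorem exists_pow_le_mul_pow {x y ε : ℝ} (hx : 0 ≤ x) (hxy : x < y) (hε : 0 < ε) :
    ∃ n m : ℕ, n ≠ 0 ∧
      ((x + y) ^ n + x ^ n - y ^ n) ^ m ≤ ε * ((x + y) ^ n + x ^ n + y ^ n) ^ m ∧
      (1 - ε) * ((x + y) ^ n + x ^ n + y ^ n) ^ m ≤ ((x + y) ^ n - x ^ n + y ^ n) ^ m := by
  have hy : 0 < y := hx.trans_lt hxy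
  obtain ⟨n, hn⟩ := exists_pow_lt_of_lt_one (show 0 < min 1 (ε ^ 2 / (1 + ε)) by positivity)
    ((div_lt_one hy).mpr hxy)
  obtain ⟨hn1, hnε⟩ := lt_min_iff.mp hn
  rw [div_pow, div_lt_div_iff₀ (by positivity) (by positivity)] at hnε
  have hn0 : n ≠ 0 := by rintro rfl; simp at hn1
  have hxn : x ^ n ≤ y ^ n := by gcongr
  have hyn : y ^ n ≤ (x + y) ^ n := by gcongr; exact le_add_of_nonneg_left hx
  have hxn0 : 0 ≤ x ^ n := by positivity
  have hyn0 : 0 < y ^ n := by positivity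
  set A := (x + y) ^ n + x ^ n + y ^ n with hA
  have hA0 : 0 < A := by linarith
  obtain ⟨m, hphase, hbit⟩ := exists_one_sub_pow_le_le_one_sub_pow (r := 2 * y ^ n / A)
    (w := 2 * x ^ n / A) hε (by positivity) (by rw [div_le_one hA0]; linarith) (by positivity)
    (by rw [div_le_one hA0]; linarith)
    (by rw [div_mul_eq_mul_div, mul_div_assoc', div_le_div_iff_of_pos_right hA0]; linarith)
  have split_phase : (x + y) ^ n + x ^ n - y ^ n = (1 - 2 * y ^ n / A) * A := by
    rw [one_sub_mul, div_mul_cancel₀ _ hA0.ne', hA]; ring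
  have split_bit : (x + y) ^ n - x ^ n + y ^ n = (1 - 2 * x ^ n / A) * A := by
    rw [one_sub_mul, div_mul_cancel₀ _ hA0.ne', hA]; ring
  refine ⟨n, m, hn0, ?_, ?_⟩
  · rw [split_phase, mul_pow]
    gcongr
  · rw [split_bit, mul_pow]
    gcongr

end ErrorRates

theorem isLOCCDistillable_isotropic {x y : ℝ} (hx : 0 ≤ x) (hxy : x < y)
    (h : IsState (isotropic x y)) : IsLOCCDistillable (isotropic (x : ℂ) y) := by
  refine isLOCCDistillable_of_filter h fun ε hε => ?_
  obtain ⟨n, m, hn, hphase, hbit⟩ := exists_pow_le_mul_pow hx hxy (half_pos hε)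
  refine ⟨m * n, concatenatedFilter hadamard m n, concatenatedFilter hadamard m n, _,
    conjMap_concatenatedFilter_tensorPower _ _ _ m n, ?_⟩
  rw [trace_decoded_isotropic x y hn m, trace_phiPlus_mul_decoded_isotropic x y hn m]
  norm_cast
  simp only [mul_pow]
  have hy : 0 < y := hx.trans_lt hxy
  have hpow : y ^ n ≤ (x + y) ^ n := by gcongr; exact le_add_of_nonneg_left hx
  have hA : 0 < ((x + y) ^ n + x ^ n + y ^ n) ^ m := by positivity
  have hB : 0 ≤ ((x + y) ^ n + x ^ n - y ^ n) ^ m :=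
    pow_nonneg (by linarith [pow_nonneg hx n]) m
  generalize ((x + y) ^ n + x ^ n + y ^ n) ^ m = A at *
  generalize ((x + y) ^ n + x ^ n - y ^ n) ^ m = B at *
  generalize ((x + y) ^ n - x ^ n + y ^ n) ^ m = C at *
  refine ⟨by positivity, ?_⟩
  calc (1 - ε) * (2 * (2 ^ m * A) + 2 * (2 ^ m * B))
      = 2 ^ m * (2 * A + 2 * B - ε * (2 * A + 2 * B)) := by ring
    _ ≤ 2 ^ m * (A + C) := by
      gcongr
      linarith [mul_pos hε hA, mul_nonneg hε.le hB]
    _ = 2 ^ m * A + 2 ^ m * C := mul_add ..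

end QEnt

end

theorem mainTheorem1 {a b : Type*} [Fintype a] [DecidableEq a] [Fintype b] [DecidableEq b]
    (ρ : Matrix (a × b) (a × b) ℂ) (hρ : IsNPTState ρ) :
    (∃ η : a × b → ℂ, IsNegativeUnitEigenvector (partialTranspose ρ) η) ∧
    ∀ η : a × b → ℂ, IsNegativeUnitEigenvector (partialTranspose ρ) η →
      IsChannel (measurePrepare (testOperator η)) ∧
      IsDuallyNonEntangling (measurePrepare (testOperator η)) ∧
      IsPPTMap (measurePrepare (testOperator η)) ∧
      IsEntangledState (measurePrepare (testOperator η) ρ) ∧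
      IsLOCCDistillable (measurePrepare (testOperator η) ρ) := by
  obtain ⟨hstate, hNPT⟩ := hρ
  refine ⟨exists_isNegativeUnitEigenvector
    (isHermitian_partialTranspose hstate.1.isHermitian) hNPT, ?_⟩
  rintro η ⟨hη, μ, hμ, heig⟩
  obtain ⟨hμ2, hout⟩ := measurePrepare_testOperator_of_eigenvector hstate hη heig
  set x : ℝ := (μ + 2) / 12 with hx
  set y : ℝ := (1 - μ) / 6 with hy
  have hx0 : 0 ≤ x := by linarith
  have hxy : x < y := by linarith
  have hout_state : IsState (isotropic x y) :=
    isState_isotropic hx0 (hx0.trans hxy.le) (by linarith)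
  have hout_entangled : ¬ IsSeparable (isotropic x y) := fun hsep =>
    hxy.not_ge (Complex.real_le_real.mp hsep.le_of_isotropic)
  rw [hout]
  exact ⟨isChannel_measurePrepare_testOperator hη,
    ⟨isNonEntangling_measurePrepare_testOperator hη,
      isNonEntangling_dualMap_measurePrepare_testOperator hη⟩,
    isPPTMap_measurePrepare_testOperator hη, ⟨hout_state, hout_entangled⟩,
    isLOCCDistillable_isotropic hx0 hxy hout_state⟩
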